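/- **Conventions.** $x^y = y^{-1}xy$, and $o(x)$ is the order of $x$. A group $G=\langle a,b,c\rangle$ is a *triangle-point group* if $a,b,c,ab$ all have order $2$ and, for all $t,s\in a^G\cup b^G\cup c^G\cup (ab)^G$, the product $ts$ has (finite) order at most $6$. For $i=1,2,3,4$ let $(3^i:2):(3^{1+2}_+:2^2)$ denote the group of order $216\cdot 3^i$ generated by $x,y,z$ subject to $$x^2=y^2=z^2=(xy)^2=(xz)^6=(yz)^6=(xyz)^6=(x\,y^z)^6=(xy\,y^z)^6=(xy\,x^z)^6=(z^x z^{yz})^3=1$$ together with, for $i=3$, the relation $z^{xzyzxzy}\,z^{yzxzyzx}=1$; for $i=2$, the relation $(x\,y^{zxyz})^2=1$; for $i=1$, the relations $(x\,y^{zxyz})^2=(xy\,x^{zyz})^2=1$; and, for $i=4$, no further relation. Let $V$ be a real inner product space with a commutative bilinear product $\cdot$ satisfying (M1) $(u,v\cdot w)=(u\cdot v,w)$ and (M2) $(u\cdot u,v\cdot v)\ge(u\cdot v,u\cdot v)$. For $e\in V$ put $V_\mu^{(e)}=\{v: e\cdot v=\mu v\}$. The vector $e$ is a *Majorana axis* if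 (M3) $(e,e)=1$, $e\cdot e=e$; (M4) $V=V_1^{(e)}\oplus V_0^{(e)}\oplus V_{1/4}^{(e)}\oplus V_{1/32}^{(e)}$; (M5) $V_1^{(e)}=\mathbb R e$; (M6) the linear map $\tau(e)$ which is $1$ on $V_+^{(e)}:=V_1^{(e)}\oplus V_0^{(e)}\oplus V_{1/4}^{(e)}$ and $-1$ on $V_{1/32}^{(e)}$ preserves the product; (M7) the linear map $\sigma(e)$ of $V_+^{(e)}$ which is $1$ on $V_1^{(e)}\oplus V_0^{(e)}$ and $-1$ on $V_{1/4}^{(e)}$ preserves the product of $V_+^{(e)}$. Two axes $a_0,a_1$ *generate a dihedral algebra of type $2A$ with third axis $a_\rho$* if the subalgebra they generate has basis $a_0,a_1,a_\rho$, these are idempotents of length $1$, any two distinct ones have inner product $\tfrac18$, and $p\cdot q=\tfrac18(p+q-r)$ whenever $\{p,q,r\}=\{a_0,a_1,a_\rho\}$. A *Majorana representation* $(G,T,V)$ consists of a finite group $G$, a conjugation-invariant set $T$ of involutions generating $G$, a space $V$ with product as above, a linear representation $\varphi$ of $G$ on $V$ (acting on the right) preserving the product and the inner product, and an injective map $\psi$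 from $T$ to the set of Majorana axes of $V$ whose image generates the algebra $V$, such that $\psi(t^g)=\psi(t)^{\varphi(g)}$ and $\varphi(t)=\tau(\psi(t))$ for all $t\in T$, $g\in G$, and (M8): for $t_0,t_1,t_2\in T$, if $\psi(t_0),\psi(t_1)$ generate a dihedral algebra of type $2A$ with third axis $a_\rho$, then $t_0t_1\in T$ and $\psi(t_0t_1)=a_\rho$; and if $t_0t_1t_2=1$, then $\psi(t_0),\psi(t_1)$ generate a dihedral algebra of type $2A$ with third axis $\psi(t_2)$. **Proposition.** Let $i\in\{1,2,3,4\}$ and let $G=\langle a,b,c\rangle\cong(3^i:2):(3^{1+2}_+:2^2)$ be a triangle-point group. Then: 1. $o(ac)=o(bc)=o(abc)=o\big(b(ac)^3\big)=6$. 2. The subgroup $K:=\langle a,b,(b(ac)^3)^3\rangle$ is elementary abelian of order $8$. 3. $K\subseteq T\cup\{e\}$ for every conjugation-invariant subset $T\subseteq G$ which contains $a,b,c,ab$ and contains $(ts)^3$ whenever $t,s\in T$ and $o(ts)=6$. 4. There is no Majorana representation $(G,T,V)$ with $a,b,c,ab\in T$. -/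

import Mathlib

/-! ### Triangle-point groups -/

/-- The conjugate `x ^ y = y⁻¹ x y`. -/
def conjBy {G : Type*} [Group G] (x y : G) : G := y⁻¹ * x * y

/-- `X = a^G ∪ b^G ∪ c^G ∪ (ab)^G`. -/
def trianglePointClasses {G : Type*} [Group G] (a b c : G) : Set G :=
  {x | ∃ s ∈ ({a, b, c, a * b} : Set G), ∃ g : G, x = conjBy s g}

/-- `G = ⟨a, b, c⟩` is a triangle-point group (with respect to the generators `a`, `b`, `c`). -/
structure IsTrianglePoint {G : Type*} [Group G] (a b c : G) : Prop where
  generates : Subgroup.closure ({a, b, c} : Set G) = ⊤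
  order_a : orderOf a = 2
  order_b : orderOf b = 2
  order_c : orderOf c = 2
  order_ab : orderOf (a * b) = 2
  order_le_six : ∀ t ∈ trianglePointClasses a b c, ∀ s ∈ trianglePointClasses a b c,
    0 < orderOf (t * s) ∧ orderOf (t * s) ≤ 6

/-! ### The groups `(3^i : 2) : (3^{1+2}_+ : 2^2)`

They are given by their presentations on three generators `a`, `b`, `c`; the orders are
`216 * 3 ^ i`, that is 648, 1944, 5832 and 17496 for `i = 1, 2, 3, 4`. -/

/-- The relators for `i = 4`. -/
def baseRelators {G : Type*} [Group G] (a b c : G) : List G :=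
  [a ^ 2, b ^ 2, c ^ 2, (a * b) ^ 2, (a * c) ^ 6, (b * c) ^ 6, (a * b * c) ^ 6,
    (a * conjBy b c) ^ 6, (a * b * conjBy b c) ^ 6, (a * b * conjBy a c) ^ 6,
    (conjBy c a * conjBy c (b * c)) ^ 3]

/-- The relators which are added in order to pass from the group for `i = 4` to its quotient
for `i = 1, 2, 3`. -/
def extraRelators {G : Type*} [Group G] (a b c : G) : ℕ → List G
  | 1 => [(a * b * conjBy a (c * b * c)) ^ 2, (a * conjBy b (c * a * b * c)) ^ 2]
  | 2 => [(a * conjBy b (c * a * b * c)) ^ 2]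
  | 3 => [conjBy c (a * c * b * c * a * c * b) * conjBy c (b * c * a * c * b * c * a)]
  | _ => []

/-- The relators of the group `(3^i : 2) : (3^{1+2}_+ : 2^2)`, as elements of the free group
on three generators. -/
def threeGroupRelators (i : ℕ) : Set (FreeGroup (Fin 3)) :=
  {w | w ∈ baseRelators (FreeGroup.of 0) (FreeGroup.of 1) (FreeGroup.of 2) ++
    extraRelators (FreeGroup.of 0) (FreeGroup.of 1) (FreeGroup.of 2) i}

/-- The group `(3^i : 2) : (3^{1+2}_+ : 2^2)`, for `i = 1, 2, 3, 4`. -/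
abbrev ThreeGroup (i : ℕ) : Type := PresentedGroup (threeGroupRelators i)

/-! ### Majorana axes

A real algebra with inner product is a real inner product space `V` (not assumed complete)
with a bilinear product `mul`. -/

section Majorana

variable {V : Type*} [NormedAddCommGroup V] [InnerProductSpace ℝ V]

/-- `V_μ^{(a)}`: the `μ`-eigenspace of the adjoint action `v ↦ a · v`. -/
def axisEigenspace (mul : V →ₗ[ℝ] V →ₗ[ℝ] V) (a : V) (μ : ℝ) : Submodule ℝ V :=
  Module.End.eigenspace (mul a) μ

/-- The four eigenvalues `1, 0, 1/2^2, 1/2^5`. -/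
noncomputable def majoranaEigenvalue : Fin 4 → ℝ := ![1, 0, 1 / 4, 1 / 32]

/-- `V_+^{(a)} = V_1 ⊕ V_0 ⊕ V_{1/4}`. -/
noncomputable def axisPlus (mul : V →ₗ[ℝ] V →ₗ[ℝ] V) (a : V) : Submodule ℝ V :=
  axisEigenspace mul a 1 ⊔ axisEigenspace mul a 0 ⊔ axisEigenspace mul a (1 / 4)

/-- `τ` is the linear transformation `τ(a)`: it is `1` on `V_1`, `V_0`, `V_{1/4}`
and `-1` on `V_{1/32}`. It is unique when `V` is the sum of these four eigenspaces. -/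
structure IsTau (mul : V →ₗ[ℝ] V →ₗ[ℝ] V) (a : V) (τ : V →ₗ[ℝ] V) : Prop where
  on_one : ∀ u ∈ axisEigenspace mul a 1, τ u = u
  on_zero : ∀ u ∈ axisEigenspace mul a 0, τ u = u
  on_quarter : ∀ u ∈ axisEigenspace mul a (1 / 4), τ u = u
  on_thirtysecond : ∀ u ∈ axisEigenspace mul a (1 / 32), τ u = -u

/-- `σ` is the linear transformation `σ(a)` of `V_+^{(a)}`: it is `1` on `V_1`, `V_0`
and `-1` on `V_{1/4}`. -/
structure IsSigma (mul : V →ₗ[ℝ] V →ₗ[ℝ] V) (a : V)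
    (σ : axisPlus mul a →ₗ[ℝ] axisPlus mul a) : Prop where
  on_one : ∀ u : axisPlus mul a, (u : V) ∈ axisEigenspace mul a 1 → σ u = u
  on_zero : ∀ u : axisPlus mul a, (u : V) ∈ axisEigenspace mul a 0 → σ u = u
  on_quarter : ∀ u : axisPlus mul a, (u : V) ∈ axisEigenspace mul a (1 / 4) → σ u = -u

/-- `a` is a Majorana axis: axioms (M3) to (M7). The product of two elements of `V_+^{(a)}`
always lies in `V_+^{(a)}` by (M6), so the proviso `h` in (M7) is no restriction. -/
structure IsMajoranaAxis (mul : V →ₗ[ℝ] V →ₗ[ℝ] V) (a : V) : Prop where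
  m3_length : inner ℝ a a = 1
  m3_idempotent : mul a a = a
  m4 : DirectSum.IsInternal fun i : Fin 4 => axisEigenspace mul a (majoranaEigenvalue i)
  m5 : axisEigenspace mul a 1 = Submodule.span ℝ {a}
  m6 : ∃ τ : V →ₗ[ℝ] V, IsTau mul a τ ∧ ∀ u v : V, mul (τ u) (τ v) = τ (mul u v)
  m7 : ∃ σ : axisPlus mul a →ₗ[ℝ] axisPlus mul a, IsSigma mul a σ ∧
    ∀ (u v : axisPlus mul a) (h : mul (u : V) (v : V) ∈ axisPlus mul a),
      mul (σ u : V) (σ v : V) = σ ⟨mul (u : V) (v : V), h⟩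

/-- The smallest subspace which contains `S` and is closed under the product. -/
def generatedSubalgebra (mul : V →ₗ[ℝ] V →ₗ[ℝ] V) (S : Set V) : Submodule ℝ V :=
  sInf {U | S ⊆ U ∧ ∀ u ∈ U, ∀ v ∈ U, mul u v ∈ U}

/-- `a₀` and `a₁` generate a dihedral algebra of type `2A`, with basis `a₀, a₁, r`
where `r` is its third axis `a_ρ`. -/
structure IsDihedral2A (mul : V →ₗ[ℝ] V →ₗ[ℝ] V) (a₀ a₁ r : V) : Prop where
  linearIndependent : LinearIndependent ℝ ![a₀, a₁, r]
  span_eq : Submodule.span ℝ {a₀, a₁, r} = generatedSubalgebra mul {a₀, a₁}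
  mul_00 : mul a₀ a₀ = a₀
  mul_11 : mul a₁ a₁ = a₁
  mul_rr : mul r r = r
  mul_01 : mul a₀ a₁ = (1 / 8 : ℝ) • (a₀ + a₁ - r)
  mul_0r : mul a₀ r = (1 / 8 : ℝ) • (a₀ + r - a₁)
  mul_1r : mul a₁ r = (1 / 8 : ℝ) • (a₁ + r - a₀)
  inner_00 : inner ℝ a₀ a₀ = 1
  inner_11 : inner ℝ a₁ a₁ = 1
  inner_rr : inner ℝ r r = 1
  inner_01 : inner ℝ a₀ a₁ = 1 / 8
  inner_0r : inner ℝ a₀ r = 1 / 8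
  inner_1r : inner ℝ a₁ r = 1 / 8

end Majorana

/-- A Majorana representation `(G, T, V, ·, ( , ), φ, ψ)` which satisfies axiom (M8).
Groups act on the left here; `φ` becomes a right action on composing it with inversion. -/
structure MajoranaRepresentation (G : Type*) [Group G] (T : Set G)
    (V : Type*) [NormedAddCommGroup V] [InnerProductSpace ℝ V] where
  finite_group : Finite G
  orderOf_eq_two : ∀ t ∈ T, orderOf t = 2
  conj_mem : ∀ g : G, ∀ t ∈ T, g * t * g⁻¹ ∈ T
  generates : Subgroup.closure T = ⊤
  mul : V →ₗ[ℝ] V →ₗ[ℝ] V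
  mul_comm : ∀ u v : V, mul u v = mul v u
  m1 : ∀ u v w : V, inner ℝ u (mul v w) = inner ℝ (mul u v) w
  m2 : ∀ u v : V, inner ℝ (mul u u) (mul v v) ≥ inner ℝ (mul u v) (mul u v)
  φ : Representation ℝ G V
  φ_mul : ∀ (g : G) (u v : V), φ g (mul u v) = mul (φ g u) (φ g v)
  φ_inner : ∀ (g : G) (u v : V), inner ℝ (φ g u) (φ g v) = inner ℝ u v
  /-- The bijection `ψ` from `T` onto the set `A = Set.range ψ` of Majorana axes. -/
  ψ : T → V
  ψ_injective : Function.Injective ψ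
  ψ_axis : ∀ t : T, IsMajoranaAxis mul (ψ t)
  ψ_generates : generatedSubalgebra mul (Set.range ψ) = ⊤
  ψ_conj : ∀ (g : G) (t : T), ψ ⟨g * t * g⁻¹, conj_mem g t t.2⟩ = φ g (ψ t)
  /-- The group element `t` acts on `V` as the Majorana involution `τ(ψ(t))`. -/
  φ_tau : ∀ t : T, IsTau mul (ψ t) (φ t)
  m8_type2A : ∀ (t₀ t₁ : T) (r : V), IsDihedral2A mul (ψ t₀) (ψ t₁) r →
    ∃ h : (t₀ : G) * t₁ ∈ T, ψ ⟨t₀ * t₁, h⟩ = r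
  m8_product : ∀ t₀ t₁ t₂ : T, (t₀ : G) * t₁ * t₂ = 1 →
    IsDihedral2A mul (ψ t₀) (ψ t₁) (ψ t₂)

/-! ### Eigenspace decomposition and fusion rules of a single axis. -/

section MajoranaAlgebra

variable {V : Type*} [NormedAddCommGroup V] [InnerProductSpace ℝ V]
  {mul : V →ₗ[ℝ] V →ₗ[ℝ] V} {e : V}

/-! The obstruction is a subgroup 2³ all of whose involutions lie in `T`. By (M8) its seven axes
would form a Fano plane in which every line is of type 2A. For axes x, y, xy, z, ..., the
differences y - xy and z - xz are 1/4-eigenvectors of x. Their product is a multiple of yz - xyz,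
again a 1/4-eigenvector, whereas fusion allows no 1/4-part; so yz and xyz have the same axis,
against injectivity of ψ (`eq_of_elementary_abelian_eight`).

To find the 2³, three homomorphisms onto S₃ are used. Any admissible triple a, b, c, not only the
triple of the presentation, realises all three patterns of images (`exists_hom_hasPattern`). A word
with images of orders 3 and 2 has order divisible by 6, and the triangle-point bound makes it
exactly 6. With u = (ac)³, the group ⟨b, u⟩ is then dihedral of order 12 and centralised by a;
adjoining its central involution z = (bu)³ to a, b gives K.

That the involutions of K lie in `T` needs `T` to contain (ts)³ whenever ts has order 6. This
closure is a hypothesis in claim 3, but must be derived from the axioms in claim 4 (`cube_mem`). If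
(ts)³ is not in `T`, the six axes of the dihedral group ⟨t, s⟩ form a hexagon whose opposite members
have product zero. Fusion then forces the inner products 7/256 (adjacent) and 39/256 (at distance
two), and at these values two distinct axes coincide (`hexagon_mul_ne_zero`). -/

theorem mem_axisEigenspace {v : V} {μ : ℝ} :
    v ∈ axisEigenspace mul e μ ↔ mul e v = μ • v :=
  Module.End.mem_eigenspace_iff

/-- Associativity of the form makes multiplication by `e` self-adjoint, so its eigenspaces for
different eigenvalues are orthogonal. -/
theorem inner_eq_zero_of_mul_eq_smul
    (hm1 : ∀ u v w : V, inner ℝ u (mul v w) = inner ℝ (mul u v) w)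
    (hee : mul e e = e) {v : V} {μ : ℝ} (hμ : μ ≠ 1) (hv : mul e v = μ • v) :
    inner ℝ e v = 0 := by
  have h := hm1 e e v
  rw [hee, hv, inner_smul_right] at h
  have : (μ - 1) * inner ℝ e v = 0 := by linarith
  exact (mul_eq_zero.1 this).resolve_left (sub_ne_zero.2 hμ)

namespace IsMajoranaAxis

/-- The 1-eigenspace is the line through the unit vector `e`, orthogonal to the other three, so the
coefficient of `e` is an inner product. -/
theorem exists_decomposition (he : IsMajoranaAxis mul e)
    (hm1 : ∀ u v w : V, inner ℝ u (mul v w) = inner ℝ (mul u v) w) (v : V) :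
    ∃ v₀ v₁ v₂ : V, v = (inner ℝ e v : ℝ) • e + v₀ + v₁ + v₂ ∧ mul e v₀ = 0 ∧
      mul e v₁ = (1 / 4 : ℝ) • v₁ ∧ mul e v₂ = (1 / 32 : ℝ) • v₂ := by
  have h := he.m4.submodule_iSup_eq_top
  have hv : v ∈ ⨆ i : Fin 4, axisEigenspace mul e (majoranaEigenvalue i) := h ▸ Submodule.mem_top
  obtain ⟨f, hf, hs⟩ := (Submodule.mem_iSup_iff_exists_finsupp _ _).1 hv
  rw [Finsupp.sum_fintype _ _ (by simp), Fin.sum_univ_four] at hs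
  have h0 := hf 0
  have h1 := hf 1
  have h2 := hf 2
  have h3 := hf 3
  simp only [majoranaEigenvalue, Matrix.cons_val] at h0 h1 h2 h3
  rw [he.m5, Submodule.mem_span_singleton] at h0
  obtain ⟨r, hr⟩ := h0
  rw [mem_axisEigenspace] at h1 h2 h3
  have hi : inner ℝ e v = r := by
    rw [← hs, ← hr, inner_add_right, inner_add_right, inner_add_right, inner_smul_right,
      he.m3_length,
      inner_eq_zero_of_mul_eq_smul hm1 he.m3_idempotent (by norm_num) h1,
      inner_eq_zero_of_mul_eq_smul hm1 he.m3_idempotent (by norm_num) h2,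
      inner_eq_zero_of_mul_eq_smul hm1 he.m3_idempotent (by norm_num) h3]
    ring
  exact ⟨f 1, f 2, f 3, by rw [hi, hr, hs], by simpa using h1, h2, h3⟩

theorem exists_decomposition_of_fixed (he : IsMajoranaAxis mul e)
    (hm1 : ∀ u v w : V, inner ℝ u (mul v w) = inner ℝ (mul u v) w)
    {τ : V →ₗ[ℝ] V} (hτ : IsTau mul e τ) {v : V} (hv : τ v = v) :
    ∃ v₀ v₁ : V, v = (inner ℝ e v : ℝ) • e + v₀ + v₁ ∧ mul e v₀ = 0 ∧
      mul e v₁ = (1 / 4 : ℝ) • v₁ := by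
  obtain ⟨v₀, v₁, v₂, h, h0, h1, h2⟩ := he.exists_decomposition hm1 v
  have t := hτ.on_one e (by simp [mem_axisEigenspace, he.m3_idempotent])
  have t0 := hτ.on_zero v₀ (by simp [mem_axisEigenspace, h0])
  have t1 := hτ.on_quarter v₁ (mem_axisEigenspace.2 h1)
  have t2 := hτ.on_thirtysecond v₂ (mem_axisEigenspace.2 h2)
  have hv' : τ v = (inner ℝ e v : ℝ) • e + v₀ + v₁ - v₂ := by
    conv_lhs => rw [h]
    rw [map_add, map_add, map_add, map_smul, t, t0, t1, t2, sub_eq_add_neg]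
  have : v₂ = 0 := by
    linear_combination (norm := module) (1 / 2 : ℝ) • (hv'.symm.trans (hv.trans h)).symm
  exact ⟨v₀, v₁, by rw [this, add_zero] at h; exact h, h0, h1⟩

/-- The `0`-part of a `τ(e)`-invariant vector `v`. -/
theorem mul_zero_part (he : IsMajoranaAxis mul e)
    (hm1 : ∀ u v w : V, inner ℝ u (mul v w) = inner ℝ (mul u v) w)
    {τ : V →ₗ[ℝ] V} (hτ : IsTau mul e τ) {v : V} (hv : τ v = v) :
    mul e (v + (3 * inner ℝ e v : ℝ) • e - (4 : ℝ) • mul e v) = 0 := by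
  obtain ⟨v₀, v₁, h, h0, h1⟩ := he.exists_decomposition_of_fixed hm1 hτ hv
  generalize (inner ℝ e v : ℝ) = r at *
  have := he.m3_idempotent
  subst h
  simp only [map_add, map_sub, map_smul, map_zero, this, h0, h1]
  module

/-- A quarter of the `1/4`-part of a `τ(e)`-invariant vector `v`. -/
theorem mul_quarter_part (he : IsMajoranaAxis mul e)
    (hm1 : ∀ u v w : V, inner ℝ u (mul v w) = inner ℝ (mul u v) w)
    {τ : V →ₗ[ℝ] V} (hτ : IsTau mul e τ) {v : V} (hv : τ v = v) :
    mul e (mul e v - (inner ℝ e v : ℝ) • e) =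
      (1 / 4 : ℝ) • (mul e v - (inner ℝ e v : ℝ) • e) := by
  obtain ⟨v₀, v₁, h, h0, h1⟩ := he.exists_decomposition_of_fixed hm1 hτ hv
  generalize (inner ℝ e v : ℝ) = r at *
  have := he.m3_idempotent
  subst h
  simp only [map_add, map_sub, map_smul, map_zero, this, h0, h1]
  module

theorem mul_mul_of_fixed (he : IsMajoranaAxis mul e)
    (hm1 : ∀ u v w : V, inner ℝ u (mul v w) = inner ℝ (mul u v) w)
    {τ : V →ₗ[ℝ] V} (hτ : IsTau mul e τ) {v : V} (hv : τ v = v) :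
    mul e (mul e v) = (1 / 4 : ℝ) • (mul e v + (3 * inner ℝ e v : ℝ) • e) := by
  have h := he.mul_quarter_part hm1 hτ hv
  rw [map_sub, map_smul, he.m3_idempotent] at h
  linear_combination (norm := module) h

/-- The vector `v - τ v` is twice the 1/32-part of `v`. -/
theorem mul_sub_tau (he : IsMajoranaAxis mul e)
    (hm1 : ∀ u v w : V, inner ℝ u (mul v w) = inner ℝ (mul u v) w)
    {τ : V →ₗ[ℝ] V} (hτ : IsTau mul e τ) (v : V) :
    mul e (v - τ v) = (1 / 32 : ℝ) • (v - τ v) := by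
  obtain ⟨v₀, v₁, v₂, h, h0, h1, h2⟩ := he.exists_decomposition hm1 v
  have t := hτ.on_one e (by simp [mem_axisEigenspace, he.m3_idempotent])
  have t0 := hτ.on_zero v₀ (by simp [mem_axisEigenspace, h0])
  have t1 := hτ.on_quarter v₁ (mem_axisEigenspace.2 h1)
  have t2 := hτ.on_thirtysecond v₂ (mem_axisEigenspace.2 h2)
  generalize (inner ℝ e v : ℝ) = r at *
  subst h
  simp only [map_add, map_sub, map_smul, map_neg, t, t0, t1, t2, h0, h1, h2,
    he.m3_idempotent]
  module

/-- The eigenvectors of `e` on which `σ(e)` acts as the sign `ε`, apart from `e`. -/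
def HasSign (mul : V →ₗ[ℝ] V →ₗ[ℝ] V) (e v : V) (ε : ℝ) : Prop :=
  (mul e v = 0 ∧ ε = 1) ∨ (mul e v = (1 / 4 : ℝ) • v ∧ ε = -1)

/-- The fusion rules of a Majorana axis for the eigenvalues `0` and `1/4`. -/
theorem fusion (he : IsMajoranaAxis mul e)
    (hm1 : ∀ u v w : V, inner ℝ u (mul v w) = inner ℝ (mul u v) w)
    {u v : V} {ε δ : ℝ} (hu : HasSign mul e u ε) (hv : HasSign mul e v δ) :
    ∃ w₀ w₁ : V, mul u v = (inner ℝ e (mul u v) : ℝ) • e + w₀ + w₁ ∧ mul e w₀ = 0 ∧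
      mul e w₁ = (1 / 4 : ℝ) • w₁ ∧
      (ε * δ) • mul u v = (inner ℝ e (mul u v) : ℝ) • e + w₀ - w₁ := by
  obtain ⟨τ, hτ, hτm⟩ := he.m6
  obtain ⟨σ, hσ, hσm⟩ := he.m7
  have fix : ∀ {x : V} {ε : ℝ}, HasSign mul e x ε → τ x = x := by
    rintro x ε (⟨h, -⟩ | ⟨h, -⟩)
    · exact hτ.on_zero x (by simp [mem_axisEigenspace, h])
    · exact hτ.on_quarter x (mem_axisEigenspace.2 h)
  have mem0 : ∀ {x : V}, mul e x = 0 → x ∈ axisPlus mul e := fun {x} h =>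
    Submodule.mem_sup_left (Submodule.mem_sup_right (by simp [mem_axisEigenspace, h]))
  have mem1 : ∀ {x : V}, mul e x = (1 / 4 : ℝ) • x → x ∈ axisPlus mul e := fun {x} h =>
    Submodule.mem_sup_right (mem_axisEigenspace.2 h)
  have meme : e ∈ axisPlus mul e := Submodule.mem_sup_left (Submodule.mem_sup_left
    (by simp [mem_axisEigenspace, he.m3_idempotent]))
  have sig : ∀ {x : V} {ε : ℝ}, HasSign mul e x ε →
      ∃ h : x ∈ axisPlus mul e, (σ ⟨x, h⟩ : V) = ε • x := by
    rintro x ε (⟨h, rfl⟩ | ⟨h, rfl⟩)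
    · refine ⟨mem0 h, ?_⟩
      rw [hσ.on_zero ⟨x, mem0 h⟩ (by simp [mem_axisEigenspace, h]), one_smul]
    · refine ⟨mem1 h, ?_⟩
      rw [hσ.on_quarter ⟨x, mem1 h⟩ (mem_axisEigenspace.2 h)]
      simp
  -- Invariance under τ leaves no 1/32-part, so the product lies in V₊ and σ may be applied to it.
  have hw : τ (mul u v) = mul u v := by rw [← hτm, fix hu, fix hv]
  obtain ⟨w₀, w₁, h, h0, h1⟩ := he.exists_decomposition_of_fixed hm1 hτ hw
  generalize (inner ℝ e (mul u v) : ℝ) = r at *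
  refine ⟨w₀, w₁, h, h0, h1, ?_⟩
  obtain ⟨mu, su⟩ := sig hu
  obtain ⟨mv, sv⟩ := sig hv
  have hmem : mul u v ∈ axisPlus mul e := by
    rw [h]
    exact add_mem (add_mem (Submodule.smul_mem _ r meme) (mem0 h0)) (mem1 h1)
  have key := hσm ⟨u, mu⟩ ⟨v, mv⟩ hmem
  rw [su, sv] at key
  have hx : (⟨mul u v, hmem⟩ : axisPlus mul e) =
      r • ⟨e, meme⟩ + ⟨w₀, mem0 h0⟩ + ⟨w₁, mem1 h1⟩ := Subtype.ext h
  simp only [hx, map_add, map_smul, LinearMap.smul_apply] at key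
  rw [hσ.on_one ⟨e, meme⟩ (by simp [mem_axisEigenspace, he.m3_idempotent]),
    hσ.on_zero ⟨w₀, mem0 h0⟩ (by simp [mem_axisEigenspace, h0]),
    hσ.on_quarter ⟨w₁, mem1 h1⟩ (mem_axisEigenspace.2 h1)] at key
  simp only [Submodule.coe_add, Submodule.coe_smul, Submodule.coe_neg] at key
  linear_combination (norm := module) key

/-- Here σ fixes the product, which removes the 1/4-part, and associativity of the form removes the
`e`-part. The next two rules also read off the sign of σ; for two 1/4-eigenvectors the `e`-part may
survive. -/
theorem mul_zero_zero (he : IsMajoranaAxis mul e)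
    (hm1 : ∀ u v w : V, inner ℝ u (mul v w) = inner ℝ (mul u v) w)
    {u v : V} (hu : mul e u = 0) (hv : mul e v = 0) : mul e (mul u v) = 0 := by
  obtain ⟨w₀, w₁, h, h0, h1, h2⟩ := he.fusion hm1 (Or.inl ⟨hu, rfl⟩) (Or.inl ⟨hv, rfl⟩)
  have hi : inner ℝ e (mul u v) = 0 := by rw [hm1, hu, inner_zero_left]
  rw [hi] at h h2
  have : mul u v = w₀ := by
    linear_combination (norm := module) (1 / 2 : ℝ) • h + (1 / 2 : ℝ) • h2
  rw [this, h0]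

theorem mul_zero_quarter (he : IsMajoranaAxis mul e)
    (hm1 : ∀ u v w : V, inner ℝ u (mul v w) = inner ℝ (mul u v) w)
    {u v : V} (hu : mul e u = 0) (hv : mul e v = (1 / 4 : ℝ) • v) :
    mul e (mul u v) = (1 / 4 : ℝ) • mul u v := by
  obtain ⟨w₀, w₁, h, h0, h1, h2⟩ := he.fusion hm1 (Or.inl ⟨hu, rfl⟩) (Or.inr ⟨hv, rfl⟩)
  have : mul u v = w₁ := by
    linear_combination (norm := module) (1 / 2 : ℝ) • h - (1 / 2 : ℝ) • h2
  rw [this, h1]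

theorem mul_quarter_quarter (he : IsMajoranaAxis mul e)
    (hm1 : ∀ u v w : V, inner ℝ u (mul v w) = inner ℝ (mul u v) w)
    {u v : V} (hu : mul e u = (1 / 4 : ℝ) • u) (hv : mul e v = (1 / 4 : ℝ) • v) :
    mul e (mul u v) = (inner ℝ e (mul u v) : ℝ) • e := by
  obtain ⟨w₀, w₁, h, h0, h1, h2⟩ := he.fusion hm1 (Or.inr ⟨hu, rfl⟩) (Or.inr ⟨hv, rfl⟩)
  generalize (inner ℝ e (mul u v) : ℝ) = r at *
  have : mul u v = r • e + w₀ := by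
    linear_combination (norm := module) (1 / 2 : ℝ) • h + (1 / 2 : ℝ) • h2
  rw [this, map_add, map_smul, he.m3_idempotent, h0, add_zero]

end IsMajoranaAxis

end MajoranaAlgebra

/-! ### Algebras of type 2A and pairs of axes fixed by each other's involutions. -/

section MajoranaAlgebra

variable {V : Type*} [NormedAddCommGroup V] [InnerProductSpace ℝ V]
  {mul : V →ₗ[ℝ] V →ₗ[ℝ] V}

theorem generatedSubalgebra_eq_span {S U : Set V} (hSU : S ⊆ U)
    (hU : U ⊆ generatedSubalgebra mul S)
    (hmul : ∀ u ∈ U, ∀ v ∈ U, mul u v ∈ Submodule.span ℝ U) :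
    Submodule.span ℝ U = generatedSubalgebra mul S := by
  refine le_antisymm (Submodule.span_le.2 hU) (sInf_le ⟨hSU.trans Submodule.subset_span, ?_⟩)
  intro u hu v hv
  induction hu using Submodule.span_induction with
  | mem x hx =>
    induction hv using Submodule.span_induction with
    | mem y hy => exact hmul x hx y hy
    | zero => simp
    | add y z _ _ h1 h2 => rw [map_add]; exact add_mem h1 h2
    | smul r y _ h => rw [map_smul]; exact Submodule.smul_mem _ _ h
  | zero => simp
  | add y z _ _ h1 h2 => rw [map_add]; exact add_mem h1 h2
  | smul r y _ h => rw [map_smul]; exact Submodule.smul_mem _ _ h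

theorem mul_mem_generatedSubalgebra {S : Set V} {u v : V} (hu : u ∈ generatedSubalgebra mul S)
    (hv : v ∈ generatedSubalgebra mul S) : mul u v ∈ generatedSubalgebra mul S := by
  refine Submodule.mem_sInf.2 fun W hW => ?_
  exact hW.2 u (Submodule.mem_sInf.1 hu W hW) v (Submodule.mem_sInf.1 hv W hW)

theorem subset_generatedSubalgebra {S : Set V} : S ⊆ generatedSubalgebra mul S :=
  fun _ hx => Submodule.mem_sInf.2 fun _ hW => hW.1 hx

/-- Two idempotents whose span with their product looks like an algebra of type `2A`. -/
theorem isDihedral2A_of_mul_mul (hcomm : ∀ u v : V, mul u v = mul v u)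
    (hm1 : ∀ u v w : V, inner ℝ u (mul v w) = inner ℝ (mul u v) w) {a b : V}
    (haa : mul a a = a) (hbb : mul b b = b) (ha : inner ℝ a a = (1 : ℝ))
    (hb : inner ℝ b b = (1 : ℝ)) (hab : inner ℝ a b = (1 / 8 : ℝ))
    (hap : mul a (mul a b) = (1 / 4 : ℝ) • (mul a b + (3 / 8 : ℝ) • a))
    (hbp : mul b (mul a b) = (1 / 4 : ℝ) • (mul a b + (3 / 8 : ℝ) • b))
    (hpp : mul (mul a b) (mul a b) = (3 / 128 : ℝ) • (a + b) - (1 / 32 : ℝ) • mul a b) :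
    IsDihedral2A mul a b (a + b - (8 : ℝ) • mul a b) := by
  have hiap : inner ℝ a (mul a b) = (1 / 8 : ℝ) := by rw [hm1, haa, hab]
  have hibp : inner ℝ b (mul a b) = (1 / 8 : ℝ) := by rw [hcomm, hm1, hbb, real_inner_comm, hab]
  have hipp : inner ℝ (mul a b) (mul a b) = (11 / 256 : ℝ) := by
    rw [← hm1, hbp, inner_smul_right, inner_add_right, inner_smul_right, hiap, hab]
    norm_num
  have hba : mul b a = mul a b := hcomm b a
  have hpa : mul (mul a b) a = mul a (mul a b) := hcomm _ _
  have hpb : mul (mul a b) b = mul b (mul a b) := hcomm _ _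
  have hiba : inner ℝ b a = (1 / 8 : ℝ) := by rw [real_inner_comm, hab]
  have hipa : inner ℝ (mul a b) a = (1 / 8 : ℝ) := by rw [real_inner_comm, hiap]
  have hipb : inner ℝ (mul a b) b = (1 / 8 : ℝ) := by rw [real_inner_comm, hibp]
  obtain ⟨p, hp⟩ : ∃ p, mul a b = p := ⟨_, rfl⟩
  rw [hp] at hap hbp hpp hiap hibp hipp hba hpa hpb hipa hipb ⊢
  have hrr : mul (a + b - (8 : ℝ) • p) (a + b - (8 : ℝ) • p) = a + b - (8 : ℝ) • p := by
    simp only [map_add, map_sub, map_smul, LinearMap.add_apply, LinearMap.sub_apply,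
      LinearMap.smul_apply, haa, hbb, hp, hba, hap, hbp, hpa, hpb, hpp]
    module
  have h01 : p = (1 / 8 : ℝ) • (a + b - (a + b - (8 : ℝ) • p)) := by module
  have h0r : mul a (a + b - (8 : ℝ) • p) =
      (1 / 8 : ℝ) • (a + (a + b - (8 : ℝ) • p) - b) := by
    simp only [map_add, map_sub, map_smul, haa, hp, hap]
    module
  have h1r : mul b (a + b - (8 : ℝ) • p) =
      (1 / 8 : ℝ) • (b + (a + b - (8 : ℝ) • p) - a) := by
    simp only [map_add, map_sub, map_smul, hbb, hba, hbp]
    module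
  have irr : inner ℝ (a + b - (8 : ℝ) • p) (a + b - (8 : ℝ) • p) = (1 : ℝ) := by
    simp only [inner_add_left, inner_add_right, inner_sub_left, inner_sub_right,
      inner_smul_left, inner_smul_right, ha, hb, hab, hiba, hiap, hibp, hipa, hipb, hipp]
    norm_num
  have i0r : inner ℝ a (a + b - (8 : ℝ) • p) = (1 / 8 : ℝ) := by
    simp only [inner_add_right, inner_sub_right, inner_smul_right, ha, hab, hiap]
    norm_num
  have i1r : inner ℝ b (a + b - (8 : ℝ) • p) = (1 / 8 : ℝ) := by
    simp only [inner_add_right, inner_sub_right, inner_smul_right, hb, hiba, hibp]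
    norm_num
  have hpgen : p ∈ generatedSubalgebra mul {a, b} := hp ▸ mul_mem_generatedSubalgebra
    (subset_generatedSubalgebra (by simp)) (subset_generatedSubalgebra (by simp))
  have hagen : a ∈ generatedSubalgebra mul {a, b} := subset_generatedSubalgebra (by simp)
  have hbgen : b ∈ generatedSubalgebra mul {a, b} := subset_generatedSubalgebra (by simp)
  have hrgen : a + b - (8 : ℝ) • p ∈ generatedSubalgebra mul {a, b} :=
    sub_mem (add_mem hagen hbgen) (Submodule.smul_mem _ _ hpgen)
  have hra := hcomm (a + b - (8 : ℝ) • p) a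
  have hrb := hcomm (a + b - (8 : ℝ) • p) b
  generalize a + b - (8 : ℝ) • p = r at *
  have mema : a ∈ Submodule.span ℝ {a, b, r} := Submodule.subset_span (by simp)
  have memb : b ∈ Submodule.span ℝ {a, b, r} := Submodule.subset_span (by simp)
  have memr : r ∈ Submodule.span ℝ {a, b, r} := Submodule.subset_span (by simp)
  refine ⟨?_, generatedSubalgebra_eq_span (by intro x; simp; tauto) ?_ ?_, haa, hbb, hrr,
    hp.trans h01, h0r, h1r, ha, hb, irr, hab, i0r, i1r⟩
  -- The Gram matrix, with 1 on the diagonal and 1/8 elsewhere, is nonsingular.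
  · rw [Fintype.linearIndependent_iff]
    intro g hg
    rw [Fin.sum_univ_three] at hg
    simp only [Matrix.cons_val] at hg
    have e0 := congrArg (inner ℝ a) hg
    have e1 := congrArg (inner ℝ b) hg
    have e2 := congrArg (inner ℝ r) hg
    have ira : inner ℝ r a = (1 / 8 : ℝ) := by rw [real_inner_comm, i0r]
    have irb : inner ℝ r b = (1 / 8 : ℝ) := by rw [real_inner_comm, i1r]
    simp only [inner_add_right, inner_smul_right, inner_zero_right, ha, hb, hab, hiba, i0r, i1r,
      irr, ira, irb] at e0 e1 e2
    intro i
    fin_cases i <;> simp only [Fin.zero_eta, Fin.mk_one, Fin.reduceFinMk] <;> linarith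
  · rintro x (rfl | rfl | rfl) <;> assumption
  · have hpm : p ∈ Submodule.span ℝ {a, b, r} := by
      rw [h01]; exact Submodule.smul_mem _ _ (sub_mem (add_mem mema memb) memr)
    have harm : mul a r ∈ Submodule.span ℝ {a, b, r} := by
      rw [h0r]; exact Submodule.smul_mem _ _ (sub_mem (add_mem mema memr) memb)
    have hbrm : mul b r ∈ Submodule.span ℝ {a, b, r} := by
      rw [h1r]; exact Submodule.smul_mem _ _ (sub_mem (add_mem memb memr) mema)
    rintro x (rfl | rfl | rfl) y (rfl | rfl | rfl)
    · rwa [haa]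
    · rwa [hp]
    · exact harm
    · rwa [hba]
    · rwa [hbb]
    · exact hbrm
    · rwa [hra]
    · rwa [hrb]
    · rwa [hrr]

namespace IsMajoranaAxis

/-- Distinct axes fixed by each other's Majorana involutions are orthogonal or of type `2A`. -/
theorem mul_eq_zero_or_isDihedral2A (hcomm : ∀ u v : V, mul u v = mul v u)
    (hm1 : ∀ u v w : V, inner ℝ u (mul v w) = inner ℝ (mul u v) w) {a b : V}
    (ha : IsMajoranaAxis mul a) (hb : IsMajoranaAxis mul b) (hne : a ≠ b)
    {τ τ' : V →ₗ[ℝ] V} (hτ : IsTau mul a τ) (hτ' : IsTau mul b τ')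
    (hτb : τ b = b) (hτa : τ' a = a) :
    mul a b = 0 ∨ ∃ r, IsDihedral2A mul a b r := by
  have main : ∀ {a b : V} {τ τ' : V →ₗ[ℝ] V}, IsMajoranaAxis mul a → IsMajoranaAxis mul b →
      IsTau mul a τ → IsTau mul b τ' → τ b = b → τ' a = a →
      mul (mul a b) (mul a b) = (3 / 16 * inner ℝ a b : ℝ) • (a + b) -
        (1 / 8 * (1 - 6 * inner ℝ a b) : ℝ) • mul a b ∧
      mul a (mul a b) = (1 / 4 : ℝ) • (mul a b + (3 * inner ℝ a b : ℝ) • a) ∧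
      (inner ℝ a b = (1 / 8 : ℝ) ∨ mul a b = (inner ℝ a b : ℝ) • a) := by
    intro a b τ τ' ha hb hτ hτ' hτb hτa
    have hap := ha.mul_mul_of_fixed hm1 hτ hτb
    have hbp := hb.mul_mul_of_fixed hm1 hτ' hτa
    have hz := ha.mul_zero_part hm1 hτ hτb
    have hq := ha.mul_quarter_part hm1 hτ hτb
    rw [hcomm b a, real_inner_comm] at hbp
    have haa := ha.m3_idempotent
    have hbb := hb.m3_idempotent
    have hba : mul b a = mul a b := hcomm b a
    have hpa : mul (mul a b) a = mul a (mul a b) := hcomm _ _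
    have hpb : mul (mul a b) b = mul b (mul a b) := hcomm _ _
    have h00 := ha.mul_zero_zero hm1 hz hz
    have h04 := ha.mul_zero_quarter hm1 hz hq
    have h44 := ha.mul_quarter_quarter hm1 hq hq
    generalize (inner ℝ a (mul (mul a b - (inner ℝ a b : ℝ) • a)
      (mul a b - (inner ℝ a b : ℝ) • a)) : ℝ) = ρ at h44
    have hip : inner ℝ a (mul a b) = inner ℝ a b := by rw [hm1, haa]
    have hia := ha.m3_length
    obtain ⟨l, hl⟩ : ∃ l : ℝ, inner ℝ a b = l := ⟨_, rfl⟩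
    obtain ⟨p, hp⟩ : ∃ p, mul a b = p := ⟨_, rfl⟩
    rw [hl, hp] at hap hip
    rw [hl, hp] at hbp h00 h04 h44 ⊢
    rw [hp] at hba hpa hpb
    simp only [map_add, map_sub, map_smul, LinearMap.add_apply, LinearMap.sub_apply,
      LinearMap.smul_apply, haa, hbb, hp, hba, hap, hbp, hpa, hpb] at h00 h04 h44
    -- Resurrection: the unknown vector a·(p·p) occurs in both fusion rules 0·0 and 0·1/4 and
    -- cancels, leaving p·p explicit.
    have hpp : mul p p = (3 / 16 * l : ℝ) • (a + b) - (1 / 8 * (1 - 6 * l) : ℝ) • p := by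
      linear_combination (norm := module) (1 / 4 : ℝ) • h00 + h04
    refine ⟨hpp, hap, ?_⟩
    rw [hpp] at h44
    simp only [map_add, map_sub, map_smul, haa, hp, hap] at h44
    -- The rule 1/4·1/4 makes (8l - 1)p a multiple of `a`. So l = 1/8, which is type 2A, or p = la;
    -- the latter on both sides gives l(a - b) = 0.
    have hrel : (8 * l - 1) • p = (32 * ρ - 3 * l + 10 * l ^ 2) • a := by
      linear_combination (norm := module) (32 : ℝ) • h44
    have hρ := congrArg (inner ℝ a) hrel
    rw [inner_smul_right, inner_smul_right, hip, hia, mul_one] at hρ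
    rw [← hρ, mul_smul] at hrel
    by_cases h8 : 8 * l - 1 = 0
    · exact Or.inl (by linarith)
    · exact Or.inr (smul_right_injective V h8 hrel)
  obtain ⟨hpp, hap, h1⟩ := main ha hb hτ hτ' hτb hτa
  obtain ⟨-, hbp, h2⟩ := main hb ha hτ' hτ hτa hτb
  rw [hcomm b a, real_inner_comm] at hbp h2
  rcases h1 with h1 | h1
  · right
    rw [h1] at hpp hap hbp
    refine ⟨_, isDihedral2A_of_mul_mul hcomm hm1 ha.m3_idempotent hb.m3_idempotent
      ha.m3_length hb.m3_length h1 ?_ ?_ ?_⟩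
    · rw [hap]; norm_num
    · rw [hbp]; norm_num
    · rw [hpp]; norm_num
  · rcases h2 with h2 | h2
    · exfalso
      -- If p = la with l = 1/8, then (b, p) equals both l and l².
      have h3 : inner ℝ b (mul a b) = (inner ℝ a b : ℝ) := by
        rw [hcomm, hm1, hb.m3_idempotent, real_inner_comm]
      have h4 : inner ℝ b a = (1 / 8 : ℝ) := by rw [real_inner_comm, h2]
      rw [h1, inner_smul_right, h4, h2] at h3
      norm_num at h3
    · left
      have h3 : (inner ℝ a b : ℝ) • (a - b) = 0 := by
        rw [smul_sub, ← h1, ← h2, sub_self]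
      rcases smul_eq_zero.1 h3 with h | h
      · rw [h1, h, zero_smul]
      · exact absurd (sub_eq_zero.1 h) hne

end IsMajoranaAxis

end MajoranaAlgebra

/-! ### The Fano plane of axes and the hexagon of axes. -/

section MajoranaAlgebra

variable {V : Type*} [NormedAddCommGroup V] [InnerProductSpace ℝ V]
  {mul : V →ₗ[ℝ] V →ₗ[ℝ] V}

namespace IsMajoranaAxis

/-- Seven axes cannot form a Fano plane in which every line is of type `2A`, unless two of them
coincide. -/
theorem eq_of_elementary_abelian_eight
    (hm1 : ∀ u v w : V, inner ℝ u (mul v w) = inner ℝ (mul u v) w)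
    {x y xy z xz yz xyz : V} (hx : IsMajoranaAxis mul x)
    (h1 : IsDihedral2A mul x y xy) (h2 : IsDihedral2A mul x z xz)
    (h3 : IsDihedral2A mul x yz xyz) (h4 : IsDihedral2A mul y z yz)
    (h5 : IsDihedral2A mul y xz xyz) (h6 : IsDihedral2A mul xy z xyz)
    (h7 : IsDihedral2A mul xy xz yz) : yz = xyz := by
  have q : ∀ {u v : V}, IsDihedral2A mul x u v → mul x (u - v) = (1 / 4 : ℝ) • (u - v) := by
    intro u v h
    rw [map_sub, h.mul_01, h.mul_0r]
    module
  have hp : mul (y - xy) (z - xz) = (-1 / 4 : ℝ) • (yz - xyz) := by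
    simp only [map_sub, LinearMap.sub_apply, h4.mul_01, h5.mul_01, h6.mul_01, h7.mul_01]
    module
  have h := hx.mul_quarter_quarter hm1 (q h1) (q h2)
  have hi : inner ℝ x (mul (y - xy) (z - xz)) = (0 : ℝ) := by
    rw [hp, inner_smul_right, inner_sub_right, h3.inner_01, h3.inner_0r]
    norm_num
  rw [hi, hp, map_smul, q h3] at h
  exact sub_eq_zero.1 (by linear_combination (norm := module) (-16 : ℝ) • h)

/-- The difference `u - v` is a 1/32-eigenvector of `x`, hence orthogonal to `x`. -/
theorem inner_eq_of_mul_sub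
    (hm1 : ∀ u v w : V, inner ℝ u (mul v w) = inner ℝ (mul u v) w) {x : V}
    (hx : IsMajoranaAxis mul x) {τ : V →ₗ[ℝ] V} (hτ : IsTau mul x τ) {u v : V} (huv : τ u = v) :
    inner ℝ x u = (inner ℝ x v : ℝ) := by
  have h := inner_eq_zero_of_mul_eq_smul hm1 hx.m3_idempotent (by norm_num)
    (hx.mul_sub_tau hm1 hτ u)
  rw [huv, inner_sub_right] at h
  linarith

/-- Relations in a dihedral algebra of six axes in which opposite axes are orthogonal. -/
theorem hexagon_relation (hcomm : ∀ u v : V, mul u v = mul v u)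
    (hm1 : ∀ u v w : V, inner ℝ u (mul v w) = inner ℝ (mul u v) w)
    {x₀ x₁ x₂ x₃ x₄ x₅ s t t' : V} {l : ℝ} {τ₀ τ₃ : V →ₗ[ℝ] V}
    (h0 : IsMajoranaAxis mul x₀) (h3 : IsMajoranaAxis mul x₃)
    (hτ₀ : IsTau mul x₀ τ₀) (hτ₃ : IsTau mul x₃ τ₃) (h03 : mul x₀ x₃ = 0)
    (e1 : τ₀ x₁ = x₅) (e5 : τ₀ x₅ = x₁) (e2 : τ₃ x₂ = x₄) (e4 : τ₃ x₄ = x₂)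
    (p01 : mul x₀ x₁ = s + (1 / 32 : ℝ) • (x₀ + x₁))
    (p05 : mul x₀ x₅ = s + (1 / 32 : ℝ) • (x₀ + x₅))
    (p32 : mul x₃ x₂ = s + (1 / 32 : ℝ) • (x₃ + x₂))
    (p34 : mul x₃ x₄ = s + (1 / 32 : ℝ) • (x₃ + x₄))
    (p02 : mul x₀ x₂ = t + (1 / 32 : ℝ) • (x₀ + x₂))
    (p04 : mul x₀ x₄ = t + (1 / 32 : ℝ) • (x₀ + x₄))
    (p31 : mul x₃ x₁ = t' + (1 / 32 : ℝ) • (x₃ + x₁))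
    (p35 : mul x₃ x₅ = t' + (1 / 32 : ℝ) • (x₃ + x₅))
    (i01 : inner ℝ x₀ x₁ = l) (i32 : inner ℝ x₃ x₂ = l) :
    (3 / 128 : ℝ) • (x₂ + x₄ - x₁ - x₅) + (6 * l - 3 / 16) • (x₃ - x₀) =
      (1 / 4 : ℝ) • (t - t') ∧
    mul x₀ t' = mul x₀ s + (1 / 64 : ℝ) • (mul x₀ (x₂ + x₄) - mul x₀ (x₁ + x₅)) := by
  have h00 := h0.m3_idempotent
  have h33 := h3.m3_idempotent
  have f0 : τ₀ (x₁ + x₅) = x₁ + x₅ := by rw [map_add, e1, e5, add_comm]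
  have f3 : τ₃ (x₂ + x₄) = x₂ + x₄ := by rw [map_add, e2, e4, add_comm]
  have i0 : inner ℝ x₀ (x₁ + x₅) = 2 * l := by
    rw [inner_add_right, ← h0.inner_eq_of_mul_sub hm1 hτ₀ e1, i01]; ring
  have i3 : inner ℝ x₃ (x₂ + x₄) = 2 * l := by
    rw [inner_add_right, ← h3.inner_eq_of_mul_sub hm1 hτ₃ e2, i32]; ring
  have z := h0.mul_zero_part hm1 hτ₀ f0
  have q := h0.mul_quarter_part hm1 hτ₀ f0
  have q3 := h3.mul_quarter_part hm1 hτ₃ f3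
  -- Orthogonality of opposite axes makes x₃ a 0-eigenvector of x₀, so it can be multiplied with the
  -- 0- and 1/4-parts of x₁ + x₅.
  have a1 := h0.mul_zero_zero hm1 h03 z
  have a2 := h0.mul_zero_quarter hm1 h03 q
  have h30 : mul x₃ x₀ = 0 := by rw [hcomm, h03]
  rw [i0] at q a1 a2
  rw [i3] at q3
  simp only [map_add, map_sub, map_smul, map_zero, h00, h33, h03, h30, p01, p05, p32, p34,
    p02, p04, p31, p35] at a1 a2 q q3 ⊢
  have hs0 : mul x₀ s = (7 / 32 : ℝ) • s + (7 / 2048 : ℝ) • (x₁ + x₅) +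
      (3 / 4 * l - 25 / 1024) • x₀ := by
    linear_combination (norm := module) (1 / 2 : ℝ) • q
  have hs3 : mul x₃ s = (7 / 32 : ℝ) • s + (7 / 2048 : ℝ) • (x₂ + x₄) +
      (3 / 4 * l - 25 / 1024) • x₃ := by
    linear_combination (norm := module) (1 / 2 : ℝ) • q3
  -- This evaluates x₀·(x₃·s), which occurs in `a1` and `a2`; the only other unknown there, x₀·t',
  -- is eliminated for the first claim and solved for in the second.
  have hz := congrArg (mul x₀) hs3
  simp only [map_add, map_smul, h03, p02, p04] at hz
  constructor
  · linear_combination (norm := module) (4 / 7 : ℝ) • a1 - (16 : ℝ) • a2 + (256 / 7 : ℝ) • hz +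
      (8 : ℝ) • hs0 - (8 : ℝ) • hs3
  · linear_combination (norm := module) (4 / 7 : ℝ) • a1 + (32 / 7 : ℝ) • hz

/-- The 1/4-part of `u + v` is a multiple of 2s plus vectors whose products with `x` are known, so
its eigenvalue equation determines x·s. -/
theorem mul_mul_sub_smul (hm1 : ∀ u v w : V, inner ℝ u (mul v w) = inner ℝ (mul u v) w)
    {x u v s : V} (hx : IsMajoranaAxis mul x) {τ : V →ₗ[ℝ] V} (hτ : IsTau mul x τ)
    (huv : τ u = v) (hvu : τ v = u) (pu : mul x u = s + (1 / 32 : ℝ) • (x + u))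
    (pv : mul x v = s + (1 / 32 : ℝ) • (x + v)) :
    mul x s = (7 / 32 : ℝ) • s + (7 / 2048 : ℝ) • (u + v) +
      (3 / 4 * inner ℝ x u - 25 / 1024 : ℝ) • x := by
  have f : τ (u + v) = u + v := by rw [map_add, huv, hvu, add_comm]
  have i : inner ℝ x (u + v) = 2 * (inner ℝ x u : ℝ) := by
    rw [inner_add_right, ← hx.inner_eq_of_mul_sub hm1 hτ huv]; ring
  have q := hx.mul_quarter_part hm1 hτ f
  rw [i] at q
  have := hx.m3_idempotent
  simp only [map_add, map_sub, map_smul, this, pu, pv] at q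
  linear_combination (norm := module) (1 / 2 : ℝ) • q

/-- For idempotents, (M2) bounds (x, y) below by the squared length of x·y. -/
theorem inner_nonneg
    (hm2 : ∀ u v : V, inner ℝ (mul u u) (mul v v) ≥ (inner ℝ (mul u v) (mul u v) : ℝ))
    {x y : V} (hx : IsMajoranaAxis mul x) (hy : IsMajoranaAxis mul y) :
    0 ≤ (inner ℝ x y : ℝ) := by
  have h := hm2 x y
  rw [hx.m3_idempotent, hy.m3_idempotent] at h
  exact le_trans real_inner_self_nonneg h

theorem inner_lt_one {x y : V} (hx : IsMajoranaAxis mul x) (hy : IsMajoranaAxis mul y)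
    (hne : x ≠ y) : (inner ℝ x y : ℝ) < 1 := by
  have h : (0 : ℝ) < inner ℝ (x - y) (x - y) :=
    lt_of_le_of_ne real_inner_self_nonneg fun h => hne (sub_eq_zero.1 (inner_self_eq_zero.1 h.symm))
  rw [inner_sub_left, inner_sub_right, inner_sub_right, hx.m3_length, hy.m3_length,
    real_inner_comm x y] at h
  linarith

/-- A dihedral algebra of three axes whose inner product is `39 / 256` would be degenerate. -/
theorem triangle_relation (hcomm : ∀ u v : V, mul u v = mul v u)
    (hm1 : ∀ u v w : V, inner ℝ u (mul v w) = inner ℝ (mul u v) w)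
    {x u v s : V} (hx : IsMajoranaAxis mul x) (hu : mul u u = u) (hv : mul v v = v)
    {τ : V →ₗ[ℝ] V} (hτ : IsTau mul x τ)
    (huv : τ u = v) (hvu : τ v = u) (pu : mul x u = s + (1 / 32 : ℝ) • (x + u))
    (pv : mul x v = s + (1 / 32 : ℝ) • (x + v)) (puv : mul u v = s + (1 / 32 : ℝ) • (u + v))
    (ixu : inner ℝ x u = (39 / 256 : ℝ))
    (us : mul u s = (7 / 32 : ℝ) • s + (7 / 2048 : ℝ) • (x + v) + (23 / 256 : ℝ) • u)
    (vs : mul v s = (7 / 32 : ℝ) • s + (7 / 2048 : ℝ) • (x + u) + (23 / 256 : ℝ) • v) :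
    (8 : ℝ) • s + (1 / 8 : ℝ) • (u + v) = (31 / 32 : ℝ) • x := by
  have f : τ (u + v) = u + v := by rw [map_add, huv, hvu, add_comm]
  have ixv : inner ℝ x v = (39 / 256 : ℝ) := by rw [← hx.inner_eq_of_mul_sub hm1 hτ huv, ixu]
  have i : inner ℝ x (u + v) = (39 / 128 : ℝ) := by
    rw [inner_add_right, ixu, ixv]; norm_num
  have xs := hx.mul_mul_sub_smul hm1 hτ huv hvu pu pv
  have z := hx.mul_zero_part hm1 hτ f
  have q := hx.mul_quarter_part hm1 hτ f
  have h00 := hx.mul_zero_zero hm1 z z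
  have h04 := hx.mul_zero_quarter hm1 z q
  have h44 := hx.mul_quarter_quarter hm1 q q
  have ixs : inner ℝ x s = (953 / 8192 : ℝ) := by
    have h := hm1 x x u
    rw [hx.m3_idempotent, pu, inner_add_right, inner_smul_right, inner_add_right, ixu,
      hx.m3_length] at h
    linarith
  generalize (inner ℝ x (mul (mul x (u + v) - (inner ℝ x (u + v) : ℝ) • x)
    (mul x (u + v) - (inner ℝ x (u + v) : ℝ) • x)) : ℝ) = ρ at h44
  rw [i] at h00 h04 h44
  rw [ixu] at xs
  have hxx := hx.m3_idempotent
  have ux := (hcomm u x).trans pu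
  have vx := (hcomm v x).trans pv
  have vu := (hcomm v u).trans puv
  have sx := hcomm s x
  have su := hcomm s u
  have sv := hcomm s v
  simp only [map_add, map_sub, map_smul, LinearMap.add_apply, LinearMap.sub_apply,
    LinearMap.smul_apply, hxx, hu, hv, pu, pv, puv, ux, vx, vu, xs, us, vs, sx, su, sv]
    at h00 h04 h44
  -- As for type 2A: x·(s·s) cancels between the rules 0·0 and 0·1/4. The rule 1/4·1/4 then puts the
  -- left side of the claim on the line through `x`, and pairing with `x` gives the scalar.
  have hss : mul s s = (693 / 65536 : ℝ) • (x + u + v) + (93 / 2048 : ℝ) • s := by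
    linear_combination (norm := module) (1 / 16 : ℝ) • h00 + (1 / 4 : ℝ) • h04
  rw [hss] at h44
  simp only [map_add, map_smul, hxx, pu, pv, xs] at h44
  have hrel : (8 : ℝ) • s + (1 / 8 : ℝ) • (u + v) =
      (64 / 13 * (16 * ρ - 4371 / 16384)) • x := by
    linear_combination (norm := module) (1024 / 13 : ℝ) • h44
  have hi := congrArg (inner ℝ x) hrel
  rw [inner_add_right, inner_smul_right, inner_smul_right, inner_smul_right, i, ixs,
    hx.m3_length] at hi
  rw [hrel]
  congr 1
  linarith

/-- In a configuration of six axes permuted by their Majorana involutions like the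
reflections of a hexagon, opposite axes are not orthogonal. -/
theorem hexagon_mul_ne_zero (hcomm : ∀ u v : V, mul u v = mul v u)
    (hm1 : ∀ u v w : V, inner ℝ u (mul v w) = inner ℝ (mul u v) w)
    (hm2 : ∀ u v : V, inner ℝ (mul u u) (mul v v) ≥ (inner ℝ (mul u v) (mul u v) : ℝ))
    {x : ℤ → V} {τ : ℤ → V →ₗ[ℝ] V} (hx : ∀ i, IsMajoranaAxis mul (x i))
    (hτ : ∀ i, IsTau mul (x i) (τ i)) (hper : ∀ i, x (i + 6) = x i)
    (hrefl : ∀ i j, τ i (x j) = x (2 * i - j)) (hne : x 0 ≠ x 4)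
    (hopp : ∀ i, mul (x i) (x (i + 3)) = 0) : False := by
  -- the vectors `x i · x (i + k) - (x i + x (i + k)) / 32`
  let S : ℤ → ℤ → V := fun i j => mul (x i) (x j) - (1 / 32 : ℝ) • (x i + x j)
  have hS : ∀ i j, mul (x i) (x j) = S i j + (1 / 32 : ℝ) • (x i + x j) := fun i j => by
    simp only [S]; module
  have Scomm : ∀ i j, S i j = S j i := fun i j => by
    simp only [S, hcomm (x i) (x j), add_comm (x i) (x j)]
  have Srefl : ∀ i j, S i j = S i (2 * i - j) := fun i j => by
    have h := (hx i).mul_sub_tau hm1 (hτ i) (x j)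
    rw [hrefl, map_sub] at h
    simp only [S]
    linear_combination (norm := module) h
  have irefl : ∀ i j, inner ℝ (x i) (x j) = (inner ℝ (x i) (x (2 * i - j)) : ℝ) := fun i j =>
    (hx i).inner_eq_of_mul_sub hm1 (hτ i) (hrefl i j)
  have cong : ∀ {i j : ℤ}, i = j ∨ i = j + 6 ∨ j = i + 6 → x i = x j := by
    rintro i j (rfl | rfl | rfl)
    · rfl
    · exact hper _
    · exact (hper _).symm
  have τcong : ∀ i j k : ℤ, (2 * i - j = k ∨ 2 * i - j = k + 6 ∨ k = 2 * i - j + 6) →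
      τ i (x j) = x k := fun i j k h => (hrefl i j).trans (cong h)
  have Scong : ∀ {i j k : ℤ}, (2 * i - j = k ∨ 2 * i - j = k + 6 ∨ k = 2 * i - j + 6) →
      S i j = S i k := fun {i j k} h => by
    rw [Srefl i j]; simp only [S]; rw [cong h]
  have Sstep : ∀ i, S (i + 1) (i + 2) = S i (i + 1) := fun i => by
    rw [Scong (k := i) (by omega), Scomm]
  have istep : ∀ i, inner ℝ (x (i + 1)) (x (i + 2)) = (inner ℝ (x i) (x (i + 1)) : ℝ) :=
    fun i => by
      rw [irefl, real_inner_comm]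
      congr 2
      omega
  have pr : ∀ {i j : ℤ} {s : V}, S i j = s → mul (x i) (x j) = s + (1 / 32 : ℝ) • (x i + x j) :=
    fun h => h ▸ hS _ _
  have S2 : ∀ i, S (i + 2) (i + 3) = S i (i + 1) := fun i => by
    have := Sstep (i + 1)
    rw [show i + 1 + 1 = i + 2 by ring, show i + 1 + 2 = i + 3 by ring] at this
    rw [this, Sstep]
  have i2 : ∀ i, inner ℝ (x (i + 2)) (x (i + 3)) = (inner ℝ (x i) (x (i + 1)) : ℝ) :=
    fun i => by
      have := istep (i + 1)
      rw [show i + 1 + 1 = i + 2 by ring, show i + 1 + 2 = i + 3 by ring] at this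
      rw [this, istep]
  have key : ∀ i, (3 / 128 : ℝ) • (x (i + 2) + x (i + 4) - x (i + 1) - x (i + 5)) +
      (6 * inner ℝ (x i) (x (i + 1)) - 3 / 16 : ℝ) • (x (i + 3) - x i) =
      (1 / 4 : ℝ) • (S i (i + 2) - S (i + 1) (i + 3)) ∧
      mul (x i) (S (i + 1) (i + 3)) = mul (x i) (S i (i + 1)) +
        (1 / 64 : ℝ) • (mul (x i) (x (i + 2) + x (i + 4)) -
          mul (x i) (x (i + 1) + x (i + 5))) := by
    intro i
    refine hexagon_relation hcomm hm1 (hx i) (hx (i + 3)) (hτ i) (hτ (i + 3)) (hopp i)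
      (τcong _ _ _ ?_) (τcong _ _ _ ?_) (τcong _ _ _ ?_) (τcong _ _ _ ?_)
      (pr rfl) (pr (Scong ?_)) (pr ?_) (pr ?_) (pr rfl) (pr (Scong ?_))
      (pr (Scomm _ _)) (pr ?_) rfl ?_
    any_goals omega
    · rw [Scomm, S2]
    · rw [Scong (k := i + 2) (by omega), Scomm, S2]
    · rw [Scong (k := i + 1) (by omega), Scomm]
    · rw [real_inner_comm, i2]
  have k0 := key 0
  have k2 := (key 2).1
  have i20 := i2 0
  norm_num only at k0 k2 i20
  rw [i20, show x 6 = x 0 from hper 0, show x 7 = x 1 from hper 1,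
    show S 2 4 = S 0 2 by rw [Scong (i := 2) (k := 0) (by omega), Scomm],
    show S 3 5 = S 1 3 by rw [Scong (i := 3) (k := 1) (by omega), Scomm]] at k2
  obtain ⟨k0, m0⟩ := k0
  have h03 : mul (x 0) (x 3) = 0 := hopp 0
  have h00 := (hx 0).m3_idempotent
  have i00 := (hx 0).m3_length
  have i03 : inner ℝ (x 0) (x 3) = (0 : ℝ) := by
    have h := hm1 (x 0) (x 0) (x 3)
    rwa [h00, h03, inner_zero_right, eq_comm] at h
  have i05 : inner ℝ (x 0) (x 5) = (inner ℝ (x 0) (x 1) : ℝ) := by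
    rw [irefl, cong (i := 2 * 0 - 5) (j := 1) (by omega)]
  have i04 : inner ℝ (x 0) (x 4) = (inner ℝ (x 0) (x 2) : ℝ) := by
    rw [irefl, cong (i := 2 * 0 - 4) (j := 2) (by omega)]
  -- The relations based at 0 and at 2 have the same right-hand side, since each triangle of
  -- alternate axes has a single vector `S`.
  have hdiff : (6 * inner ℝ (x 0) (x 1) - 21 / 128 : ℝ) • (x 2 - x 5 + x 3 - x 0) = 0 := by
    linear_combination (norm := module) k0 - k2
  rcases smul_eq_zero.1 hdiff with hl | hd
  swap
  -- Vanishing of the vector would give (x₀, x₄) = 1 + (x₀, x₁) ≥ 1, impossible for distinct unit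
  -- vectors.
  · have h := congrArg (inner ℝ (x 0)) hd
    rw [inner_sub_right, inner_add_right, inner_sub_right, inner_zero_right, i03, i00, i05,
      ← i04] at h
    have h1 := inner_nonneg hm2 (hx 0) (hx 1)
    have h2 := inner_lt_one (hx 0) (hx 4) hne
    linarith
  have hl : inner ℝ (x 0) (x 1) = (7 / 256 : ℝ) := by linarith
  have q1 := (hx 0).mul_mul_sub_smul hm1 (hτ 0) (τcong 0 1 5 (by omega)) (τcong 0 5 1 (by omega))
    (hS 0 1) (pr (Scong (by omega)))
  have tri : ∀ i j k : ℤ, τ i (x j) = x k → τ i (x k) = x j → S i j = S 0 2 → S i k = S 0 2 →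
      mul (x i) (S 0 2) = (7 / 32 : ℝ) • S 0 2 + (7 / 2048 : ℝ) • (x j + x k) +
        (3 / 4 * inner ℝ (x i) (x j) - 25 / 1024 : ℝ) • x i := fun i j k h1 h2 h3 h4 =>
    (hx i).mul_mul_sub_smul hm1 (hτ i) h1 h2 (pr h3) (pr h4)
  have S04 : S 0 4 = S 0 2 := Scong (by omega)
  have S20 : S 2 0 = S 0 2 := Scomm _ _
  have S24 : S 2 4 = S 0 2 := (Scong (by omega)).trans S20
  have S40 : S 4 0 = S 0 2 := (Scomm _ _).trans S04
  have S42 : S 4 2 = S 0 2 := (Scomm _ _).trans S24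
  have q2 := tri 0 2 4 (τcong _ _ _ (by omega)) (τcong _ _ _ (by omega)) rfl S04
  have p01 := hS 0 1
  have p02 := hS 0 2
  have p04 := pr S04
  have p05 : mul (x 0) (x 5) = _ := pr (Scong (k := 1) (by omega))
  -- Multiplying the relation based at 0 by x₀ leaves only a multiple of x₀.
  have hm : inner ℝ (x 0) (x 2) = (39 / 256 : ℝ) := by
    have h := congrArg (mul (x 0)) k0
    simp only [map_add, map_sub, map_smul, h03, h00, q2, m0, q1, p01, p02, p04, p05, hl] at h
    have : (inner ℝ (x 0) (x 2) - 39 / 256 : ℝ) • x 0 = 0 := by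
      linear_combination (norm := module) (-16 / 3 : ℝ) • h
    rcases smul_eq_zero.1 this with h | h
    · linarith
    · rw [h] at i00; simp at i00
  have i24 : inner ℝ (x 2) (x 4) = (39 / 256 : ℝ) := by
    rw [irefl, cong (i := 2 * 2 - 4) (j := 0) (by omega), real_inner_comm, hm]
  have i42 : inner ℝ (x 4) (x 2) = (39 / 256 : ℝ) := by rw [real_inner_comm, i24]
  have i20 : inner ℝ (x 2) (x 0) = (39 / 256 : ℝ) := by rw [real_inner_comm, hm]
  have i40 : inner ℝ (x 4) (x 0) = (39 / 256 : ℝ) := by rw [real_inner_comm, i04, hm]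
  have t0 := tri 0 2 4 (τcong _ _ _ (by omega)) (τcong _ _ _ (by omega)) rfl S04
  have t2 := tri 2 0 4 (τcong _ _ _ (by omega)) (τcong _ _ _ (by omega)) S20 S24
  have t4 := tri 4 0 2 (τcong _ _ _ (by omega)) (τcong _ _ _ (by omega)) S40 S42
  rw [hm] at t0
  rw [i20] at t2
  rw [i40] at t4
  norm_num only at t0 t2 t4
  have r0 := triangle_relation hcomm hm1 (hx 0) (hx 2).m3_idempotent (hx 4).m3_idempotent (hτ 0)
    (τcong 0 2 4 (by omega)) (τcong 0 4 2 (by omega)) p02 p04 (pr S24) hm t2 t4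
  have r4 := triangle_relation hcomm hm1 (hx 4) (hx 0).m3_idempotent (hx 2).m3_idempotent (hτ 4)
    (τcong 4 0 2 (by omega)) (τcong 4 2 0 (by omega)) (pr S40) (pr S42) p02 i40
    (by rw [t0, add_comm (x 2) (x 4)]) (by rw [t2, add_comm (x 0) (x 4)])
  -- Both relations contain the same vector `S 0 2`, so their difference is a nonzero multiple of x₀
  -- - x₄.
  have : x 0 - x 4 = 0 := by
    linear_combination (norm := module) (32 / 35 : ℝ) • (r4 - r0)
  exact hne (sub_eq_zero.1 this)

end IsMajoranaAxis

end MajoranaAlgebra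

/-! ### Homomorphisms to S₃ and orders of words. -/

section GroupPart

/-- The three patterns `(s, 1, t)`, `(1, s, t)`, `(s, s, t)` of involutions generating `S₃`. -/
def symThreePattern : Fin 3 → Fin 3 → Equiv.Perm (Fin 3) :=
  ![![Equiv.swap 0 1, 1, Equiv.swap 1 2], ![1, Equiv.swap 0 1, Equiv.swap 1 2],
    ![Equiv.swap 0 1, Equiv.swap 0 1, Equiv.swap 1 2]]

set_option maxRecDepth 4000 in
theorem lift_symThreePattern_eq_one (i : ℕ) (k : Fin 3) :
    ∀ r ∈ threeGroupRelators i, FreeGroup.lift (symThreePattern k) r = 1 := by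
  intro r hr
  have hr' : r ∈ baseRelators (FreeGroup.of 0) (FreeGroup.of 1) (FreeGroup.of 2) ++
    extraRelators (FreeGroup.of 0) (FreeGroup.of 1) (FreeGroup.of 2) i := hr
  rw [List.mem_append] at hr'
  rcases hr' with h | h
  · simp only [baseRelators, List.mem_cons, List.not_mem_nil, or_false] at h
    rcases h with rfl | rfl | rfl | rfl | rfl | rfl | rfl | rfl | rfl | rfl | rfl <;>
    simp only [conjBy, map_pow, map_mul, map_inv, FreeGroup.lift_apply_of] <;>
    fin_cases k <;> decide
  · match i, h with
    | 0, h => simp [extraRelators] at h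
    | 1, h =>
      simp only [extraRelators, List.mem_cons, List.not_mem_nil, or_false] at h
      rcases h with rfl | rfl <;>
      simp only [conjBy, map_pow, map_mul, map_inv, FreeGroup.lift_apply_of] <;>
      fin_cases k <;> decide
    | 2, h =>
      simp only [extraRelators, List.mem_cons, List.not_mem_nil, or_false] at h
      subst h
      simp only [conjBy, map_pow, map_mul, map_inv, FreeGroup.lift_apply_of]
      fin_cases k <;> decide
    | 3, h =>
      simp only [extraRelators, List.mem_cons, List.not_mem_nil, or_false] at h
      subst h
      simp only [conjBy, map_mul, map_inv, FreeGroup.lift_apply_of]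
      fin_cases k <;> decide
    | (n + 4), h => simp [extraRelators] at h

/-- The three projections of `ThreeGroup i` to `S₃`. -/
def toSymThree (i : ℕ) (k : Fin 3) : ThreeGroup i →* Equiv.Perm (Fin 3) :=
  PresentedGroup.toGroup (lift_symThreePattern_eq_one i k)

theorem toSymThree_of (i : ℕ) (k j : Fin 3) :
    toSymThree i k (PresentedGroup.of j) = symThreePattern k j :=
  PresentedGroup.toGroup.of _

/-- The elements `x, y, z` of `S₃` realise the pattern `k`, up to conjugation. -/
def HasPattern (k : Fin 3) (x y z : Equiv.Perm (Fin 3)) : Prop :=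
  ∃ g, x = g * symThreePattern k 0 * g⁻¹ ∧ y = g * symThreePattern k 1 * g⁻¹ ∧
    z = g * symThreePattern k 2 * g⁻¹

instance (k : Fin 3) (x y z : Equiv.Perm (Fin 3)) : Decidable (HasPattern k x y z) := by
  unfold HasPattern; infer_instance

/-- In S₃, commuting elements of order at most 2 are equal unless one is trivial, and ordered pairs
of distinct transpositions are all conjugate; the non-commuting alternative excludes degenerate
triples. -/
theorem exists_hasPattern : ∀ x y z : Equiv.Perm (Fin 3), x ^ 2 = 1 → y ^ 2 = 1 → z ^ 2 = 1 →
    x * y = y * x → (x * z ≠ z * x ∨ y * z ≠ z * y) → ∃ k, HasPattern k x y z := by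
  decide

variable {G : Type*} [Group G] {a b c : G}

theorem eq_of_eq_on_generators (hgen : Subgroup.closure ({a, b, c} : Set G) = ⊤)
    {M : Type*} [Group M] {f g : G →* M} (ha : f a = g a) (hb : f b = g b) (hc : f c = g c) :
    f = g :=
  MonoidHom.eq_of_eqOn_dense hgen (by rintro x (rfl | rfl | rfl) <;> assumption)

theorem mul_comm_of_generators (hgen : Subgroup.closure ({a, b, c} : Set G) = ⊤)
    {M : Type*} [Group M] (f : G →* M) (hab : f a * f b = f b * f a)
    (hac : f a * f c = f c * f a) (hbc : f b * f c = f c * f b) (x y : G) :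
    f x * f y = f y * f x := by
  have gens : ∀ u ∈ ({a, b, c} : Set G), ∀ v ∈ ({a, b, c} : Set G), f u * f v = f v * f u := by
    rintro u (rfl | rfl | rfl) v (rfl | rfl | rfl) <;> first | rfl | assumption | (symm; assumption)
  have h1 : ∀ u ∈ ({a, b, c} : Set G), ∀ y, f u * f y = f y * f u := by
    intro u hu y
    have hy : y ∈ Subgroup.closure ({a, b, c} : Set G) := hgen ▸ Subgroup.mem_top y
    induction hy using Subgroup.closure_induction with
    | mem v hv => exact gens u hu v hv
    | one => simp
    | mul v w _ _ h1 h2 => rw [map_mul, ← mul_assoc, h1, mul_assoc, h2, mul_assoc]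
    | inv v _ h => rw [map_inv]; exact (Commute.inv_right (show Commute (f u) (f v) from h)).eq
  have hx : x ∈ Subgroup.closure ({a, b, c} : Set G) := hgen ▸ Subgroup.mem_top x
  induction hx using Subgroup.closure_induction with
  | mem v hv => exact h1 v hv y
  | one => simp
  | mul v w _ _ h1 h2 => rw [map_mul, mul_assoc, h2, ← mul_assoc, h1, mul_assoc]
  | inv v _ h => rw [map_inv]; exact (Commute.inv_left (show Commute (f v) (f y) from h)).eq

theorem sign_eq_of_hasPattern : ∀ (k : Fin 3) (g x : Equiv.Perm (Fin 3)) (j : Fin 3),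
    x = g * symThreePattern k j * g⁻¹ →
    Equiv.Perm.sign x = Equiv.Perm.sign (symThreePattern k j) := by
  rintro k g x j rfl
  rw [map_mul, map_mul, map_inv, mul_right_comm, mul_inv_cancel, one_mul]

/-- Three generating involutions of `ThreeGroup i`, two of which commute, realise all the three
patterns in `S₃`. -/
theorem exists_hom_hasPattern {i : ℕ} (hG : Nonempty (G ≃* ThreeGroup i))
    (habc : IsTrianglePoint a b c) (k : Fin 3) :
    ∃ f : G →* Equiv.Perm (Fin 3), HasPattern k (f a) (f b) (f c) := by
  obtain ⟨φ⟩ := hG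
  let π : Fin 3 → G →* Equiv.Perm (Fin 3) := fun k => (toSymThree i k).comp φ.toMonoidHom
  have hπ : ∀ k j, π k (φ.symm (PresentedGroup.of j)) = symThreePattern k j := fun k j => by
    simp [π, toSymThree_of]
  have sq : ∀ {x : G}, orderOf x = 2 → x ^ 2 = 1 := fun {x} h => h ▸ pow_orderOf_eq_one x
  have ha := sq habc.order_a
  have hb := sq habc.order_b
  have hc := sq habc.order_c
  have hab := sq habc.order_ab
  have hcomm : a * b = b * a := by
    have e1 : a⁻¹ = a := inv_eq_of_mul_eq_one_right (by rw [← pow_two, ha])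
    have e2 : b⁻¹ = b := inv_eq_of_mul_eq_one_right (by rw [← pow_two, hb])
    have e3 : (a * b)⁻¹ = a * b := inv_eq_of_mul_eq_one_right (by rw [← pow_two, hab])
    rw [← e3, mul_inv_rev, e1, e2]
  have pat : ∀ k, ∃ l, HasPattern l (π k a) (π k b) (π k c) := by
    intro k
    refine exists_hasPattern _ _ _ (by rw [← map_pow, ha, map_one])
      (by rw [← map_pow, hb, map_one]) (by rw [← map_pow, hc, map_one])
      (by rw [← map_mul, hcomm, map_mul]) ?_
    by_contra! hcon
    have h := fun j j' => mul_comm_of_generators habc.generates (π k)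
      (by rw [← map_mul, hcomm, map_mul]) hcon.1 hcon.2 (φ.symm (PresentedGroup.of j))
      (φ.symm (PresentedGroup.of j'))
    simp only [hπ] at h
    revert h
    fin_cases k <;> decide
  choose l hl using pat
  -- Signs are unchanged by conjugation and distinguish the three patterns. Equal patterns on a, b,
  -- c would give equal sign characters on G, but these differ on the presentation's generators.
  -- Injectivity on a three-element set then yields every pattern.
  have hinj : Function.Injective l := by
    intro k k' hkk
    obtain ⟨g, e0, e1, e2⟩ := hl k
    obtain ⟨g', e0', e1', e2'⟩ := hl k'
    rw [← hkk] at e0' e1' e2'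
    have hs : Equiv.Perm.sign.comp (π k) = Equiv.Perm.sign.comp (π k') := by
      apply eq_of_eq_on_generators habc.generates
      · exact (sign_eq_of_hasPattern _ _ _ _ e0).trans (sign_eq_of_hasPattern _ _ _ _ e0').symm
      · exact (sign_eq_of_hasPattern _ _ _ _ e1).trans (sign_eq_of_hasPattern _ _ _ _ e1').symm
      · exact (sign_eq_of_hasPattern _ _ _ _ e2).trans (sign_eq_of_hasPattern _ _ _ _ e2').symm
    have hdec : ∀ k k', (∀ j, Equiv.Perm.sign (symThreePattern k j) =
        Equiv.Perm.sign (symThreePattern k' j)) → k = k' := by decide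
    refine hdec k k' fun j => ?_
    rw [← hπ, ← hπ]
    exact DFunLike.congr_fun hs _
  obtain ⟨k', rfl⟩ := (Finite.injective_iff_surjective.1 hinj) k
  exact ⟨π k', hl k'⟩

/-- Orders of words in three generating involutions, from their images in `S₃`. -/
theorem six_dvd_orderOf {i : ℕ} (hG : Nonempty (G ≃* ThreeGroup i))
    (habc : IsTrianglePoint a b c) (w : FreeGroup (Fin 3)) (k l : Fin 3)
    (hk : FreeGroup.lift (symThreePattern k) w ^ 3 = 1)
    (hk' : FreeGroup.lift (symThreePattern k) w ≠ 1)
    (hl : FreeGroup.lift (symThreePattern l) w ^ 2 = 1)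
    (hl' : FreeGroup.lift (symThreePattern l) w ≠ 1) :
    6 ∣ orderOf (FreeGroup.lift ![a, b, c] w) := by
  have key : ∀ k, orderOf (FreeGroup.lift (symThreePattern k) w) ∣
      orderOf (FreeGroup.lift ![a, b, c] w) := by
    intro k
    obtain ⟨f, g, e0, e1, e2⟩ := exists_hom_hasPattern hG habc k
    have h : ((MulAut.conj g⁻¹).toMonoidHom.comp f).comp (FreeGroup.lift ![a, b, c]) =
        FreeGroup.lift (symThreePattern k) := by
      ext1 j
      fin_cases j <;> simp [e0, e1, e2, mul_assoc]
    rw [← h]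
    exact orderOf_map_dvd ((MulAut.conj g⁻¹).toMonoidHom.comp f) _
  have h3 := key k
  have h2 := key l
  rw [orderOf_eq_prime hk hk'] at h3
  rw [orderOf_eq_prime hl hl'] at h2
  exact Nat.Coprime.mul_dvd_of_dvd_of_dvd (m := 3) (n := 2) (by norm_num) h3 h2

theorem orderOf_eq_six {t s : G} (habc : IsTrianglePoint a b c)
    (ht : t ∈ trianglePointClasses a b c) (hs : s ∈ trianglePointClasses a b c)
    (h : 6 ∣ orderOf (t * s)) : orderOf (t * s) = 6 :=
  le_antisymm (habc.order_le_six t ht s hs).2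
    (Nat.le_of_dvd (habc.order_le_six t ht s hs).1 h)

theorem conjBy_mem_trianglePointClasses {s : G} (hs : s ∈ ({a, b, c, a * b} : Set G)) (g : G) :
    conjBy s g ∈ trianglePointClasses a b c := ⟨s, hs, g, rfl⟩

theorem mem_trianglePointClasses {s : G} (hs : s ∈ ({a, b, c, a * b} : Set G)) :
    s ∈ trianglePointClasses a b c := ⟨s, hs, 1, by simp [conjBy]⟩

theorem IsTrianglePoint.sq_eq_one (h : IsTrianglePoint a b c) :
    a * a = 1 ∧ b * b = 1 ∧ c * c = 1 ∧ a * b = b * a := by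
  have sq : ∀ {x : G}, orderOf x = 2 → x * x = 1 := fun {x} h => by
    rw [← pow_two, ← h, pow_orderOf_eq_one]
  have ha := sq h.order_a
  have hb := sq h.order_b
  refine ⟨ha, hb, sq h.order_c, ?_⟩
  have e1 : a⁻¹ = a := inv_eq_of_mul_eq_one_right ha
  have e2 : b⁻¹ = b := inv_eq_of_mul_eq_one_right hb
  have e3 : (a * b)⁻¹ = a * b := inv_eq_of_mul_eq_one_right (sq h.order_ab)
  rw [← e3, mul_inv_rev, e1, e2]

/-- The conjugate `c ^ (a c)` as a word in involutions. -/
theorem conjBy_mul_eq (ha : a * a = 1) (hc : c * c = 1) :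
    conjBy c (a * c) = a * (a * c) ^ 3 := by
  have e1 : a⁻¹ = a := inv_eq_of_mul_eq_one_right ha
  have e3 : c⁻¹ = c := inv_eq_of_mul_eq_one_right hc
  rw [conjBy, mul_inv_rev, e1, e3, pow_succ, pow_two]
  simp only [← mul_assoc, ha, one_mul]

theorem orderOf_words {i : ℕ} (hG : Nonempty (G ≃* ThreeGroup i))
    (habc : IsTrianglePoint a b c) :
    orderOf (a * c) = 6 ∧ orderOf (b * c) = 6 ∧ orderOf (a * b * c) = 6 ∧
      orderOf (b * (a * c) ^ 3) = 6 ∧ orderOf (b * (a * (a * c) ^ 3)) = 6 := by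
  obtain ⟨ha, hb, hc, hab⟩ := habc.sq_eq_one
  have m : ∀ {s : G}, s ∈ ({a, b, c, a * b} : Set G) → s ∈ trianglePointClasses a b c :=
    mem_trianglePointClasses
  have md : a * (a * c) ^ 3 ∈ trianglePointClasses a b c := by
    rw [← conjBy_mul_eq ha hc]
    exact conjBy_mem_trianglePointClasses (by simp) _
  have word : ∀ {w : FreeGroup (Fin 3)} {g : G}, 6 ∣ orderOf (FreeGroup.lift ![a, b, c] w) →
      FreeGroup.lift ![a, b, c] w = g → 6 ∣ orderOf g := fun h e => e ▸ h
  refine ⟨orderOf_eq_six habc (m (by simp)) (m (by simp)) ?_,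
    orderOf_eq_six habc (m (by simp)) (m (by simp)) ?_,
    orderOf_eq_six habc (m (by simp)) (m (by simp)) ?_, ?_,
    orderOf_eq_six habc (m (by simp)) md ?_⟩
  · exact word (six_dvd_orderOf hG habc (FreeGroup.of 0 * FreeGroup.of 2) 0 1
      (by simp only [map_mul, FreeGroup.lift_apply_of]; decide)
      (by simp only [map_mul, FreeGroup.lift_apply_of]; decide)
      (by simp only [map_mul, FreeGroup.lift_apply_of]; decide)
      (by simp only [map_mul, FreeGroup.lift_apply_of]; decide))
      (by simp only [map_mul, FreeGroup.lift_apply_of]; rfl)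
  · exact word (six_dvd_orderOf hG habc (FreeGroup.of 1 * FreeGroup.of 2) 1 0
      (by simp only [map_mul, FreeGroup.lift_apply_of]; decide)
      (by simp only [map_mul, FreeGroup.lift_apply_of]; decide)
      (by simp only [map_mul, FreeGroup.lift_apply_of]; decide)
      (by simp only [map_mul, FreeGroup.lift_apply_of]; decide))
      (by simp only [map_mul, FreeGroup.lift_apply_of]; rfl)
  · exact word (six_dvd_orderOf hG habc (FreeGroup.of 0 * FreeGroup.of 1 * FreeGroup.of 2) 0 2
      (by simp only [map_mul, FreeGroup.lift_apply_of]; decide)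
      (by simp only [map_mul, FreeGroup.lift_apply_of]; decide)
      (by simp only [map_mul, FreeGroup.lift_apply_of]; decide)
      (by simp only [map_mul, FreeGroup.lift_apply_of]; decide))
      (by simp only [map_mul, FreeGroup.lift_apply_of]; rfl)
  -- The factor (ac)³ is not known to lie in the triangle-point classes, so the word is rewritten as
  -- ab times c^(ac), to which the order bound applies.
  · have e : b * (a * c) ^ 3 = a * b * (a * (a * c) ^ 3) := by
      rw [hab, mul_assoc b a, ← mul_assoc a a, ha, one_mul]
    rw [e]
    refine orderOf_eq_six habc (m (by simp)) md ?_
    rw [← e]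
    exact word (six_dvd_orderOf hG habc
      (FreeGroup.of 1 * (FreeGroup.of 0 * FreeGroup.of 2) ^ 3) 1 2
      (by simp only [map_mul, map_pow, FreeGroup.lift_apply_of]; decide)
      (by simp only [map_mul, map_pow, FreeGroup.lift_apply_of]; decide)
      (by simp only [map_mul, map_pow, FreeGroup.lift_apply_of]; decide)
      (by simp only [map_mul, map_pow, FreeGroup.lift_apply_of]; decide))
      (by simp only [map_mul, map_pow, FreeGroup.lift_apply_of]; rfl)
  · exact word (six_dvd_orderOf hG habc
      (FreeGroup.of 1 * (FreeGroup.of 0 * (FreeGroup.of 0 * FreeGroup.of 2) ^ 3)) 1 0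
      (by simp only [map_mul, map_pow, FreeGroup.lift_apply_of]; decide)
      (by simp only [map_mul, map_pow, FreeGroup.lift_apply_of]; decide)
      (by simp only [map_mul, map_pow, FreeGroup.lift_apply_of]; decide)
      (by simp only [map_mul, map_pow, FreeGroup.lift_apply_of]; decide))
      (by simp only [map_mul, map_pow, FreeGroup.lift_apply_of]; rfl)

/-! ### The elementary abelian subgroup of order 8. -/

/-- Identities for the central involution `z` of a dihedral group `⟨b, u⟩` of order `12` and an
involution `a` which centralises it. -/
theorem dihedral_twelve_identities {u z : G} (ha : a * a = 1) (hb : b * b = 1) (hu : u * u = 1)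
    (hab : Commute a b) (hau : Commute a u) (hbu : (b * u) ^ 6 = 1) (hz : (b * u) ^ 3 = z) :
    z * z = 1 ∧ Commute a z ∧ Commute b z ∧ a * z = (b * (a * u)) ^ 3 ∧
      b * z = (b * u)⁻¹ * u * (b * u) ∧ a * b * z = (b * u)⁻¹ * (a * u) * (b * u) := by
  have e2 : b⁻¹ = b := inv_eq_of_mul_eq_one_right hb
  have e3 : u⁻¹ = u := inv_eq_of_mul_eq_one_right hu
  have hzz : z * z = 1 := by rw [← hz, ← pow_add, hbu]
  have hbz : b * z = (b * u)⁻¹ * u * (b * u) := by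
    rw [← hz, mul_inv_rev, e2, e3, pow_succ, pow_two]
    simp only [← mul_assoc, hb, one_mul]
  have haw : Commute a (b * u) := hab.mul_right hau
  refine ⟨hzz, hz ▸ haw.pow_right 3, ?_, ?_, hbz, ?_⟩
  · have h : b * z * b⁻¹ = z⁻¹ := by
      rw [← hz, ← conj_pow, ← inv_pow, mul_inv_rev, e2, e3]
      simp only [← mul_assoc, hb, one_mul]
    rw [inv_eq_of_mul_eq_one_right hzz] at h
    exact mul_inv_eq_iff_eq_mul.1 h
  · rw [show b * (a * u) = a * (b * u) by rw [← mul_assoc, ← mul_assoc, hab.eq],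
      haw.mul_pow, hz, pow_succ, pow_two, ha, one_mul]
  · rw [mul_assoc, hbz, ← mul_assoc a, ← mul_assoc a, haw.inv_right.eq, mul_assoc _ a u]

theorem triangle_identities (habc : IsTrianglePoint a b c) (h1 : orderOf (a * c) = 6)
    (h2 : orderOf (b * (a * c) ^ 3) = 6) {z : G} (hz : (b * (a * c) ^ 3) ^ 3 = z) :
    z * z = 1 ∧ Commute a z ∧ Commute b z ∧ a * z = (b * (a * (a * c) ^ 3)) ^ 3 ∧
      b * z = (b * (a * c) ^ 3)⁻¹ * (a * c) ^ 3 * (b * (a * c) ^ 3) ∧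
      a * b * z = (b * (a * c) ^ 3)⁻¹ * (a * (a * c) ^ 3) * (b * (a * c) ^ 3) := by
  obtain ⟨ha, hb, hc, hab⟩ := habc.sq_eq_one
  have hu : (a * c) ^ 3 * (a * c) ^ 3 = 1 := by
    rw [← pow_add]
    have h := pow_orderOf_eq_one (a * c)
    rw [h1] at h
    exact h
  refine dihedral_twelve_identities ha hb hu hab ?_ (h2 ▸ pow_orderOf_eq_one _) hz
  -- Conjugation by a inverts ac, hence fixes the involution (ac)³.
  have h : a * (a * c) ^ 3 * a⁻¹ = ((a * c) ^ 3)⁻¹ := by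
    rw [← conj_pow, ← inv_pow, mul_inv_rev, inv_eq_of_mul_eq_one_right ha,
      inv_eq_of_mul_eq_one_right hc]
    simp only [← mul_assoc, ha, one_mul]
  rw [inv_eq_of_mul_eq_one_right hu] at h
  exact mul_inv_eq_iff_eq_mul.1 h

/-- The seven involutions of `⟨a, b, z⟩` belong to `T`. -/
theorem involutions_mem {i : ℕ} (hG : Nonempty (G ≃* ThreeGroup i))
    (habc : IsTrianglePoint a b c) {T : Set G} (ha : a ∈ T) (hb : b ∈ T) (hc : c ∈ T)
    (hab : a * b ∈ T) (hconj : ∀ g : G, ∀ t ∈ T, g * t * g⁻¹ ∈ T)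
    (hcube : ∀ t ∈ T, ∀ s ∈ T, orderOf (t * s) = 6 → (t * s) ^ 3 ∈ T)
    {z : G} (hz : (b * (a * c) ^ 3) ^ 3 = z) :
    z ∈ T ∧ a * z ∈ T ∧ b * z ∈ T ∧ a * b * z ∈ T := by
  obtain ⟨o1, -, -, o2, o3⟩ := orderOf_words hG habc
  obtain ⟨-, -, -, e1, e2, e3⟩ := triangle_identities habc o1 o2 hz
  obtain ⟨haa, hbb, hcc, hcomm⟩ := habc.sq_eq_one
  have hconj' : ∀ g : G, ∀ t ∈ T, g⁻¹ * t * g ∈ T := fun g t ht => by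
    simpa using hconj g⁻¹ t ht
  have hu := hcube a ha c hc o1
  have hd : a * (a * c) ^ 3 ∈ T := by
    rw [← conjBy_mul_eq haa hcc]; exact hconj' _ c hc
  have e : b * (a * c) ^ 3 = a * b * (a * (a * c) ^ 3) := by
    rw [hcomm, mul_assoc b a, ← mul_assoc a a, haa, one_mul]
  refine ⟨?_, ?_, ?_, ?_⟩
  · rw [← hz, e]
    exact hcube _ hab _ hd (e ▸ o2)
  · rw [e1]; exact hcube b hb _ hd o3
  · rw [e2]; exact hconj' _ _ hu
  · rw [e3]; exact hconj' _ _ hd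

/-- The homomorphism from `2³` to a group given by three commuting involutions. -/
def homOfInvolutions (a b z : G) (ha : a * a = 1) (hb : b * b = 1) (hz : z * z = 1)
    (hab : Commute a b) (haz : Commute a z) (hbz : Commute b z) :
    Multiplicative (Fin 3 → ZMod 2) →* G :=
  MonoidHom.mk' (fun v => a ^ (v.toAdd 0).val * b ^ (v.toAdd 1).val * z ^ (v.toAdd 2).val) <| by
    have key : ∀ {x : G}, x * x = 1 → ∀ s t : ZMod 2, x ^ (s + t).val = x ^ s.val * x ^ t.val := by
      intro x hx s t
      rw [← pow_add, ZMod.val_add, ← pow_mod_orderOf x (s.val + t.val),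
        ← pow_mod_orderOf x ((s.val + t.val) % 2),
        Nat.mod_mod_of_dvd _ (orderOf_dvd_of_pow_eq_one (by rw [pow_two, hx]))]
    intro v w
    simp only [toAdd_mul, Pi.add_apply, key ha, key hb, key hz]
    have h1 : Commute (b ^ (v.toAdd 1).val) (a ^ (w.toAdd 0).val) := hab.symm.pow_pow _ _
    have h2 : Commute (z ^ (v.toAdd 2).val) (a ^ (w.toAdd 0).val) := haz.symm.pow_pow _ _
    have h3 : Commute (z ^ (v.toAdd 2).val) (b ^ (w.toAdd 1).val) := hbz.symm.pow_pow _ _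
    rw [(h2.mul_right h3).mul_mul_mul_comm, h1.mul_mul_mul_comm]

theorem homOfInvolutions_range {a b z : G} (ha : a * a = 1) (hb : b * b = 1) (hz : z * z = 1)
    (hab : Commute a b) (haz : Commute a z) (hbz : Commute b z) :
    (homOfInvolutions a b z ha hb hz hab haz hbz).range =
      Subgroup.closure ({a, b, z} : Set G) := by
  apply le_antisymm
  · rintro _ ⟨v, rfl⟩
    exact mul_mem (mul_mem (pow_mem (Subgroup.subset_closure (by simp)) _)
      (pow_mem (Subgroup.subset_closure (by simp)) _))
      (pow_mem (Subgroup.subset_closure (by simp)) _)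
  · rw [Subgroup.closure_le]
    rintro x (rfl | rfl | rfl)
    · exact ⟨Multiplicative.ofAdd ![1, 0, 0], by simp [homOfInvolutions, ZMod.val_one]⟩
    · exact ⟨Multiplicative.ofAdd ![0, 1, 0], by simp [homOfInvolutions, ZMod.val_one]⟩
    · exact ⟨Multiplicative.ofAdd ![0, 0, 1], by simp [homOfInvolutions, ZMod.val_one]⟩

/-- An element of the elementary abelian group is trivial or one of the seven products. -/
theorem homOfInvolutions_apply_mem {a b z : G} (ha : a * a = 1) (hb : b * b = 1) (hz : z * z = 1)
    (hab : Commute a b) (haz : Commute a z) (hbz : Commute b z)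
    (v : Multiplicative (Fin 3 → ZMod 2)) :
    v = 1 ∨ homOfInvolutions a b z ha hb hz hab haz hbz v ∈
      ({a, b, a * b, z, a * z, b * z, a * b * z} : Set G) := by
  have h2 : ∀ x : ZMod 2, x = 0 ∨ x = 1 := by decide
  change v = 1 ∨ a ^ (v.toAdd 0).val * b ^ (v.toAdd 1).val * z ^ (v.toAdd 2).val ∈ _
  rcases h2 (v.toAdd 0) with e0 | e0 <;> rcases h2 (v.toAdd 1) with e1 | e1 <;>
    rcases h2 (v.toAdd 2) with e2 | e2
  · left
    apply Multiplicative.toAdd.injective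
    funext j
    fin_cases j <;> assumption
  all_goals
    right
    rw [e0, e1, e2]
    simp [ZMod.val_one]

end GroupPart

/-! ### Consequences for Majorana representations. -/

section Representation

namespace MajoranaRepresentation

variable {G : Type*} [Group G] {T : Set G} {V : Type*} [NormedAddCommGroup V]
  [InnerProductSpace ℝ V]

theorem sq_eq_one (M : MajoranaRepresentation G T V) {t : G} (ht : t ∈ T) : t * t = 1 := by
  rw [← pow_two, ← M.orderOf_eq_two t ht, pow_orderOf_eq_one]

/-- If the product of two involutions in `T` has order `6`, then its cube lies in `T`. -/
theorem cube_mem (M : MajoranaRepresentation G T V) {t s : G} (ht : t ∈ T) (hs : s ∈ T)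
    (h : orderOf (t * s) = 6) : (t * s) ^ 3 ∈ T := by
  by_contra hcube
  have ht2 := M.sq_eq_one ht
  have hs2 := M.sq_eq_one hs
  have hti : t⁻¹ = t := inv_eq_of_mul_eq_one_right ht2
  have hsi : s⁻¹ = s := inv_eq_of_mul_eq_one_right hs2
  obtain ⟨r, hr⟩ : ∃ r, t * s = r := ⟨_, rfl⟩
  rw [hr] at h hcube
  have htr : t * r = s := by rw [← hr, ← mul_assoc, ht2, one_mul]
  have hsemi : SemiconjBy t r r⁻¹ := by
    rw [SemiconjBy, htr, ← hr, mul_inv_rev, hti, hsi, mul_assoc, ht2, mul_one]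
  have hz : ∀ k : ℤ, t * r ^ k = r ^ (-k) * t := fun k => by
    have := (hsemi.zpow_right k).eq
    rwa [inv_zpow, ← zpow_neg] at this
  have hr6 : r ^ (6 : ℤ) = 1 := by
    have := pow_orderOf_eq_one r
    rw [h] at this
    exact_mod_cast this
  have hpow : ∀ n : ℕ, 0 < n → n < 6 → r ^ (n : ℤ) ≠ 1 := fun n h0 h6 hn => by
    rw [zpow_natCast] at hn
    have := Nat.le_of_dvd h0 (orderOf_dvd_of_pow_eq_one hn)
    omega
  -- These reflections are conjugates of t for even k and of s for odd k.
  have hmem : ∀ k : ℤ, t * r ^ k ∈ T := by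
    intro k
    have hconj : ∀ (k : ℤ) (x : G), x ∈ T → r ^ (-k) * x * r ^ k ∈ T := fun k x hx => by
      have := M.conj_mem (r ^ (-k)) x hx
      rwa [zpow_neg, inv_inv, ← zpow_neg] at this
    obtain ⟨m, rfl | rfl⟩ := Int.even_or_odd' k
    · rw [two_mul, zpow_add, ← mul_assoc, hz]
      exact hconj m t ht
    · rw [show 2 * m + 1 = m + 1 + m by ring, zpow_add, zpow_add, ← mul_assoc, ← mul_assoc, hz,
        mul_assoc (r ^ (-m)), zpow_one, htr]
      exact hconj m s hs
  let x : ℤ → V := fun k => M.ψ ⟨t * r ^ k, hmem k⟩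
  have hne : ∀ {j k : ℤ}, x j = x k → r ^ j = r ^ k := fun e => by
    have := congrArg Subtype.val (M.ψ_injective e)
    exact mul_left_cancel this
  have hper : ∀ k, x (k + 6) = x k := fun k => by
    simp only [x, zpow_add, hr6, mul_one]
  have hax : ∀ k, IsMajoranaAxis M.mul (x k) := fun k => M.ψ_axis _
  have hτ : ∀ k, IsTau M.mul (x k) (M.φ (t * r ^ k)) := fun k => M.φ_tau ⟨_, hmem k⟩
  have hrefl : ∀ j k, M.φ (t * r ^ j) (x k) = x (2 * j - k) := fun j k => by
    have h1 := M.ψ_conj (t * r ^ j) ⟨t * r ^ k, hmem k⟩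
    rw [← h1]
    have e : t * r ^ j * (t * r ^ k) * (t * r ^ j)⁻¹ = t * r ^ (2 * j - k) := by
      rw [mul_inv_rev, hti, ← zpow_neg, ← mul_assoc, mul_assoc (t * r ^ j),
        mul_assoc t (r ^ k), ← zpow_add, hz, ← mul_assoc, mul_assoc _ t t, ht2, mul_one,
        mul_assoc, hz, ← mul_assoc, ← zpow_add]
      congr 2
      ring
    simp only [x]
    congr 2
  refine IsMajoranaAxis.hexagon_mul_ne_zero M.mul_comm M.m1 M.m2 hax hτ hper hrefl ?_ ?_
  · intro e
    exact hpow 4 (by norm_num) (by norm_num) ((hne e).symm.trans (zpow_zero r))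
  · intro k
    have h3 : x k ≠ x (k + 3) := fun e => by
      have := hne e
      rw [zpow_add] at this
      exact hpow 3 (by norm_num) (by norm_num) (mul_eq_left.1 this.symm)
    have f1 : M.φ (t * r ^ k) (x (k + 3)) = x (k + 3) := by
      rw [hrefl, ← hper]; congr 1; ring
    have f2 : M.φ (t * r ^ (k + 3)) (x k) = x k := by
      rw [hrefl, ← hper k]; congr 1; ring
    -- Opposite reflections have product r³, so type 2A would put r³ into `T` by (M8).
    rcases IsMajoranaAxis.mul_eq_zero_or_isDihedral2A M.mul_comm M.m1 (hax k) (hax (k + 3)) h3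
      (hτ k) (hτ (k + 3)) f1 f2 with h0 | ⟨ρ, hρ⟩
    · exact h0
    · exfalso
      obtain ⟨hm, -⟩ := M.m8_type2A ⟨_, hmem k⟩ ⟨_, hmem (k + 3)⟩ ρ hρ
      apply hcube
      have e : t * r ^ k * (t * r ^ (k + 3)) = r ^ 3 := by
        rw [hz, mul_assoc, ← mul_assoc t t, ht2, one_mul, ← zpow_add]
        have : -k + (k + 3) = ((3 : ℕ) : ℤ) := by push_cast; ring
        rw [this, zpow_natCast]
      rw [← e]
      exact hm

/-- The involutions of an elementary abelian group of order `8` do not all belong to `T`. -/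
theorem not_elementary_abelian_eight (M : MajoranaRepresentation G T V) {x y z : G}
    (hx : x ∈ T) (hy : y ∈ T) (hxy : x * y ∈ T) (hz : z ∈ T) (hxz : x * z ∈ T) (hyz : y * z ∈ T)
    (hxyz : x * y * z ∈ T) (cxy : Commute x y) : False := by
  have sx := M.sq_eq_one hx
  have dih : ∀ {t u v : G} (ht : t ∈ T) (hu : u ∈ T) (hv : v ∈ T), t * u = v →
      IsDihedral2A M.mul (M.ψ ⟨t, ht⟩) (M.ψ ⟨u, hu⟩) (M.ψ ⟨v, hv⟩) := fun ht hu hv e =>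
    M.m8_product ⟨_, ht⟩ ⟨_, hu⟩ ⟨_, hv⟩ (by rw [e]; exact M.sq_eq_one hv)
  have key := IsMajoranaAxis.eq_of_elementary_abelian_eight M.m1 (M.ψ_axis ⟨x, hx⟩)
    (dih hx hy hxy rfl) (dih hx hz hxz rfl) (dih hx hyz hxyz (mul_assoc x y z).symm)
    (dih hy hz hyz rfl) (dih hy hxz hxyz (by rw [← mul_assoc, cxy.eq]))
    (dih hxy hz hxyz rfl) (dih hxy hxz hyz (by
      rw [cxy.eq, mul_assoc, ← mul_assoc x x, sx, one_mul]))
  have h := congrArg Subtype.val (M.ψ_injective key)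
  simp only [mul_assoc x y z] at h
  have h1 : x = 1 := mul_eq_right.1 h.symm
  have h2 := M.orderOf_eq_two x hx
  rw [h1, orderOf_one] at h2
  exact absurd h2 (by norm_num)

end MajoranaRepresentation
end Representation

/-! ### Assembly of the four claims. -/

theorem mainTheorem12 {G : Type*} [Group G] (i : ℕ) (hi₁ : 1 ≤ i) (hi₄ : i ≤ 4)
    (hG : Nonempty (G ≃* ThreeGroup i)) (a b c : G) (habc : IsTrianglePoint a b c) :
    (orderOf (a * c) = 6 ∧ orderOf (b * c) = 6 ∧ orderOf (a * b * c) = 6 ∧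
      orderOf (b * (a * c) ^ 3) = 6) ∧
    Nonempty (Subgroup.closure ({a, b, (b * (a * c) ^ 3) ^ 3} : Set G) ≃*
      Multiplicative (Fin 3 → ZMod 2)) ∧
    (∀ T : Set G, a ∈ T → b ∈ T → c ∈ T → a * b ∈ T →
      (∀ g : G, ∀ t ∈ T, g * t * g⁻¹ ∈ T) →
      (∀ t ∈ T, ∀ s ∈ T, orderOf (t * s) = 6 → (t * s) ^ 3 ∈ T) →
      (Subgroup.closure ({a, b, (b * (a * c) ^ 3) ^ 3} : Set G) : Set G) ⊆ T ∪ {1}) ∧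
    (∀ T : Set G, a ∈ T → b ∈ T → c ∈ T → a * b ∈ T →
      ∀ (V : Type*) [NormedAddCommGroup V] [InnerProductSpace ℝ V],
        IsEmpty (MajoranaRepresentation G T V)) := by
  obtain ⟨o1, o2, o3, o4, o5⟩ := orderOf_words hG habc
  obtain ⟨z, hz⟩ : ∃ z, (b * (a * c) ^ 3) ^ 3 = z := ⟨_, rfl⟩
  obtain ⟨hzz, haz, hbz, -⟩ := triangle_identities habc o1 o4 hz
  obtain ⟨haa, hbb, -, hab⟩ := habc.sq_eq_one
  have hF := homOfInvolutions_range haa hbb hzz hab haz hbz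
  have hmem := homOfInvolutions_apply_mem haa hbb hzz hab haz hbz
  rw [hz]
  refine ⟨⟨o1, o2, o3, o4⟩, ?_, ?_, ?_⟩
  -- The set of all involutions satisfies the closure conditions, which shows that the products
  -- involving z have order 2 and hence that the map from 2³ is injective.
  · have h := involutions_mem hG habc (T := {x | orderOf x = 2}) habc.order_a habc.order_b
      habc.order_c habc.order_ab (fun g t ht => by
        have : orderOf (MulAut.conj g t) = orderOf t := MulEquiv.orderOf_eq _ _
        exact this.trans ht)
      (fun t _ s _ h => by
        change orderOf ((t * s) ^ 3) = 2
        rw [orderOf_pow_of_dvd (by norm_num) (by rw [h]; norm_num), h]) hz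
    obtain ⟨h1, h2, h3, h4⟩ := h
    have hinj : Function.Injective (homOfInvolutions a b z haa hbb hzz hab haz hbz) := by
      refine (injective_iff_map_eq_one _).2 fun v hv => (hmem v).resolve_right fun hm => ?_
      have : ∀ x ∈ ({a, b, a * b, z, a * z, b * z, a * b * z} : Set G), orderOf x = 2 := by
        rintro x (rfl | rfl | rfl | rfl | rfl | rfl | rfl)
        exacts [habc.order_a, habc.order_b, habc.order_ab, h1, h2, h3, h4]
      have h := this _ hm
      rw [hv, orderOf_one] at h
      exact absurd h (by norm_num)
    exact ⟨((MonoidHom.ofInjective hinj).trans (MulEquiv.subgroupCongr hF)).symm⟩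
  · intro T ha hb hc habT hconj hcube x hx
    obtain ⟨h1, h2, h3, h4⟩ := involutions_mem hG habc ha hb hc habT hconj hcube hz
    rw [← hF] at hx
    obtain ⟨v, rfl⟩ := hx
    rcases hmem v with rfl | h
    · exact Or.inr (map_one _)
    · left
      rcases h with h | h | h | h | h | h | h <;> rw [h] <;> assumption
  · intro T ha hb hc habT V _ _
    refine ⟨fun M => ?_⟩
    obtain ⟨h1, h2, h3, h4⟩ := involutions_mem hG habc ha hb hc habT M.conj_mem
      (fun t ht s hs h => M.cube_mem ht hs h) hz
    exact M.not_elementary_abelian_eight ha hb habT h1 h2 h3 h4 hab
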